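/- Let $p\ge 1$, $0<\alpha_1<1$, $\alpha_2:=1-\alpha_1$, let $\mu_1\neq\mu_2$ in $\mathbb{R}^p$, and let $\Sigma\in\mathbb{R}^{p\times p}$ be symmetric positive definite. Let $x_1,x_2,\dots$ be independent random vectors with the two-group normal mixture law $\alpha_1\mathcal N_p(\mu_1,\Sigma)+\alpha_2\mathcal N_p(\mu_2,\Sigma)$. Put $$\theta:=\Sigma^{-1}(\mu_2-\mu_1),\qquad \beta:=\alpha_1\alpha_2,\qquad \tau:=(\mu_2-\mu_1)'\Sigma^{-1}(\mu_2-\mu_1).$$ With $\bar x:=\frac1n\sum_{i=1}^n x_i$ and $\tilde x_i:=x_i-\bar x$, define on the unit sphere $\mathbb S^{p-1}$ the sample skewness, the sample kurtosis and the hybrid index $$\gamma_n(u):=\frac{\frac1n\sum_{i=1}^n(u'\tilde x_i)^3}{\{\frac1n\sum_{i=1}^n(u'\tilde x_i)^2\}^{3/2}},\qquad \kappa_n(u):=\frac{\frac1n\sum_{i=1}^n(u'\tilde x_i)^4}{\{\frac1n\sum_{i=1}^n(u'\tilde x_i)^2\}^{2}},\qquad \eta_n(u):=w_1\gamma_n(u)^2+w_2\{\kappa_n(u)-3\}^2,$$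 where $w_1,w_2>0$ are fixed weights (for instance with $w_1+w_2=1$). Let $u_n$ be any sequence of random vectors such that, almost surely, $u_n$ is a maximizer of $\eta_n$ over $\mathbb S^{p-1}$ for all sufficiently large $n$. Then there exists a sequence of random signs $s_n\in\{-1,1\}$ such that, as $n\to\infty$, 1) $s_nu_n\to\theta/\|\theta\|$ almost surely; 2) $\sqrt n\,(s_nu_n-\theta/\|\theta\|)\rightsquigarrow\mathcal N_p(0,\Psi_\eta)$, where $$\Psi_\eta:=C_\eta\left(\frac{1+\beta\tau}{\|\theta\|^2\beta}\right)\left(I_p-\frac{\theta\theta'}{\|\theta\|^2}\right)\Sigma^{-1}\left(I_p-\frac{\theta\theta'}{\|\theta\|^2}\right),$$ that is, $C_\eta$ times the limiting covariance matrix of the linear discriminant analysis estimator of $\theta/\|\theta\|$, and $$C_\eta:=\frac{(1+\beta\tau)(1-4\beta)\left(9w_1^2(1+\beta\tau)(2+6\beta\tau+\beta\tau^2)+24w_1w_2\tau^2\beta(1-6\beta)(6+\tau)\right)+16w_2^2\tau(1-6\beta)^2\Delta}{\beta\tau^2\{3w_1(1+\beta\tau)(1-4\beta)+4w_2\tau(1-6\beta)^2\}^2},$$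 $$\Delta:=6+24\beta\tau+9\beta(1-2\beta)\tau^2+\beta(1-3\beta)\tau^3.$$ -/

import Mathlib

open MeasureTheory ProbabilityTheory Filter Topology

noncomputable section

namespace HybridPP

/-- The two-group normal mixture `α₁ N_p(μ₁, S) + (1 - α₁) N_p(μ₂, S)` with common covariance
matrix `S`: the marginal law of `x` when `y ∼ Ber(α₁)` and
`x | y ∼ N_p(y μ₁ + (1 - y) μ₂, S)`. -/
def normalMixture {p : ℕ} (α₁ : ℝ) (μ₁ μ₂ : EuclideanSpace ℝ (Fin p))
    (S : Matrix (Fin p) (Fin p) ℝ) : Measure (EuclideanSpace ℝ (Fin p)) :=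
  ENNReal.ofReal α₁ • multivariateGaussian μ₁ S
    + ENNReal.ofReal (1 - α₁) • multivariateGaussian μ₂ S

/-- The linear discriminant direction `θ = S⁻¹ (μ₂ - μ₁)`. -/
def discriminant {p : ℕ} (μ₁ μ₂ : EuclideanSpace ℝ (Fin p))
    (S : Matrix (Fin p) (Fin p) ℝ) : EuclideanSpace ℝ (Fin p) :=
  Matrix.toEuclideanCLM (𝕜 := ℝ) S⁻¹ (μ₂ - μ₁)

/-- The squared Mahalanobis distance `τ = (μ₂ - μ₁)' S⁻¹ (μ₂ - μ₁)` between the groups. -/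
def mahalanobisSq {p : ℕ} (μ₁ μ₂ : EuclideanSpace ℝ (Fin p))
    (S : Matrix (Fin p) (Fin p) ℝ) : ℝ :=
  inner ℝ (μ₂ - μ₁) (Matrix.toEuclideanCLM (𝕜 := ℝ) S⁻¹ (μ₂ - μ₁))

/-- The sample mean of the first `n` observations. -/
def sampleMean {p : ℕ} (x : ℕ → EuclideanSpace ℝ (Fin p)) (n : ℕ) :
    EuclideanSpace ℝ (Fin p) :=
  (n : ℝ)⁻¹ • ∑ i ∈ Finset.range n, x i

/-- The `k`-th centered sample moment of the projections of the first `n` observations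
on `u`. -/
def sampleMoment {p : ℕ} (x : ℕ → EuclideanSpace ℝ (Fin p)) (n k : ℕ)
    (u : EuclideanSpace ℝ (Fin p)) : ℝ :=
  (n : ℝ)⁻¹ * ∑ i ∈ Finset.range n, (inner ℝ u (x i - sampleMean x n)) ^ k

/-- The sample skewness `γ_n(u)`. -/
def sampleSkewness {p : ℕ} (x : ℕ → EuclideanSpace ℝ (Fin p)) (n : ℕ)
    (u : EuclideanSpace ℝ (Fin p)) : ℝ :=
  sampleMoment x n 3 u / (sampleMoment x n 2 u) ^ (3 / 2 : ℝ)

/-- The sample kurtosis `κ_n(u)`. -/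
def sampleKurtosis {p : ℕ} (x : ℕ → EuclideanSpace ℝ (Fin p)) (n : ℕ)
    (u : EuclideanSpace ℝ (Fin p)) : ℝ :=
  sampleMoment x n 4 u / (sampleMoment x n 2 u) ^ 2

/-- The hybrid projection index `η_n(u) = w₁ γ_n(u)² + w₂ (κ_n(u) - 3)²`. -/
def hybridIndex {p : ℕ} (w₁ w₂ : ℝ) (x : ℕ → EuclideanSpace ℝ (Fin p)) (n : ℕ)
    (u : EuclideanSpace ℝ (Fin p)) : ℝ :=
  w₁ * sampleSkewness x n u ^ 2 + w₂ * (sampleKurtosis x n u - 3) ^ 2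

/-- `u` is a maximizer of `f` over the unit sphere. -/
def IsSphereMaximizer {p : ℕ} (f : EuclideanSpace ℝ (Fin p) → ℝ)
    (u : EuclideanSpace ℝ (Fin p)) : Prop :=
  u ∈ Metric.sphere (0 : EuclideanSpace ℝ (Fin p)) 1 ∧
    IsMaxOn f (Metric.sphere (0 : EuclideanSpace ℝ (Fin p)) 1) u

/-- The matrix `I - v v' / ‖v‖²` of the orthogonal projection onto the complement of `v`. -/
def orthoProj {p : ℕ} (v : EuclideanSpace ℝ (Fin p)) : Matrix (Fin p) (Fin p) ℝ :=
  1 - (‖v‖ ^ 2)⁻¹ • Matrix.vecMulVec v.ofLp v.ofLp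

/-- The limiting covariance matrix of the linear discriminant analysis estimator,
`((1 + βτ) / (‖θ‖² β)) (I - θθ'/‖θ‖²) S⁻¹ (I - θθ'/‖θ‖²)`, with `β = α₁ (1 - α₁)`. -/
def ldaCovariance {p : ℕ} (α₁ : ℝ) (μ₁ μ₂ : EuclideanSpace ℝ (Fin p))
    (S : Matrix (Fin p) (Fin p) ℝ) : Matrix (Fin p) (Fin p) ℝ :=
  ((1 + α₁ * (1 - α₁) * mahalanobisSq μ₁ μ₂ S)
      / (‖discriminant μ₁ μ₂ S‖ ^ 2 * (α₁ * (1 - α₁)))) •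
    (orthoProj (discriminant μ₁ μ₂ S) * S⁻¹ * orthoProj (discriminant μ₁ μ₂ S))

/-- The polynomial `Δ` in the constant of proportionality. -/
def deltaPoly (β τ : ℝ) : ℝ :=
  6 + 24 * β * τ + 9 * β * (1 - 2 * β) * τ ^ 2 + β * (1 - 3 * β) * τ ^ 3

/-- The constant of proportionality `C_η`. -/
def hybridConst (β τ w₁ w₂ : ℝ) : ℝ :=
  (1 + β * τ) * (1 - 4 * β) *
      (9 * w₁ ^ 2 * (1 + β * τ) * (2 + 6 * β * τ + β * τ ^ 2)
        + 24 * w₁ * w₂ * τ ^ 2 * β * (1 - 6 * β) * (6 + τ))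
    / (β * τ ^ 2 *
        (3 * w₁ * (1 + β * τ) * (1 - 4 * β) + 4 * w₂ * τ * (1 - 6 * β) ^ 2) ^ 2)
  + 16 * w₂ ^ 2 * τ * (1 - 6 * β) ^ 2 * deltaPoly β τ
    / (β * τ ^ 2 *
        (3 * w₁ * (1 + β * τ) * (1 - 4 * β) + 4 * w₂ * τ * (1 - 6 * β) ^ 2) ^ 2)

end HybridPP

end

/-! Write h = μ₂ - μ₁, so that Sθ = h, and center the observations at the mean of the mixture, which
leaves the index unchanged. The component means become multiples of h.

Population. In a direction u put v = u'Su, t = u'h and r = t² / (v + βt²). The squared skewness is a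
multiple of r³ and the squared excess kurtosis a multiple of r⁴, with factors 1 - 4β and (1 - 6β)²
that are nonnegative and never vanish together. So the index increases strictly with r, and
Cauchy-Schwarz for S makes θ its only maximizer up to scale and sign (`popIndex_centeredMixture`,
`le_of_index_le`, `eq_of_popIndex_le`). One strong law for fourth tensor powers gives convergence of
all empirical moments along convergent directions (`ae_momentsConverge`), and compactness of the
sphere then gives consistency (`MomentsConverge.tendsto_maximizer`).

Linearization. The index is invariant under scaling, so a maximizer may be rescaled to θ + d with d
orthogonal to h, and the first order condition holds in every direction. Under the centered law ⟪θ,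
z⟫ is independent of the projections orthogonal to h. Testing with directions B e, where B inverts
the residual covariance, therefore reduces the second derivative to a scalar, `curvature`. This
yields, path by path, d = -curvature⁻¹ • `scoreAvg` up to a little-o of the empirical averages
themselves (`IsProjectionModel.isLittleO_add_scoreAvg`), and normalization adds the projection
orthogonal to θ.

Limit law. Those averages, times √n, are bounded in probability by Chebyshev, so the remainder is
negligible (`tendstoInMeasure_sqrt_smul_of_isLittleO`) and the multivariate central limit theorem
applies to the influence terms. By independence their covariance is the second moment of the score
times the projected S⁻¹; its ratio to the squared curvature produces C_η (`integral_score_sq`). -/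

noncomputable section

namespace HybridPP

/-! ### Moments of Gaussian measures -/

/-- The `k`-th raw moment of the real Gaussian law with mean `m` and variance `v`. -/
def gaussMoment (v : ℝ) : ℕ → ℝ → ℝ
  | 0, _ => 1
  | 1, m => m
  | k + 2, m => m * gaussMoment v (k + 1) m + (k + 1) * v * gaussMoment v k m

lemma gaussMoment_succ (v : ℝ) (k : ℕ) (m : ℝ) :
    gaussMoment v (k + 1) m = m * gaussMoment v k m + k * v * gaussMoment v (k - 1) m := by
  cases k with
  | zero => simp [gaussMoment]
  | succ k => simp [gaussMoment]

/-- Appell property: differentiating in the mean lowers the order by one. At k = 0 the factor k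
makes the truncated index `k - 1` harmless. -/
lemma hasDerivAt_gaussMoment (v : ℝ) (k : ℕ) (m : ℝ) :
    HasDerivAt (gaussMoment v k) (k * gaussMoment v (k - 1) m) m := by
  induction k using Nat.strong_induction_on generalizing m with
  | _ k ih =>
    match k with
    | 0 => simpa [gaussMoment] using hasDerivAt_const m (1 : ℝ)
    | 1 => simpa [gaussMoment] using hasDerivAt_id' m
    | k + 2 =>
      have h1 := ih (k + 1) (by omega) m
      have h0 := ih k (by omega) m
      have := ((hasDerivAt_id m).mul h1).add (h0.const_mul ((k + 1) * v))
      refine this.congr_deriv ?_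
      rw [Nat.add_sub_cancel, show k + 2 - 1 = k + 1 by omega, gaussMoment_succ v k m]
      simp only [id]
      push_cast
      ring

/-- Each derivative of the moment generating function multiplies the polynomial factor by m + vt and
adds v times its own derivative, which is exactly the recursion of `gaussMoment`. -/
lemma iteratedDeriv_exp_quadratic (m v : ℝ) (k : ℕ) :
    iteratedDeriv k (fun t => Real.exp (m * t + v * t ^ 2 / 2)) =
      fun t => gaussMoment v k (m + v * t) * Real.exp (m * t + v * t ^ 2 / 2) := by
  induction k with
  | zero => simp [gaussMoment]
  | succ k ih =>
    rw [iteratedDeriv_succ, ih]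
    ext t
    have hl : HasDerivAt (fun t => m + v * t) v t := by
      simpa using ((hasDerivAt_id t).const_mul v).const_add m
    have hq : HasDerivAt (fun t => m * t + v * t ^ 2 / 2) (m + v * t) t := by
      have := ((hasDerivAt_id t).const_mul m).add
        ((((hasDerivAt_id t).pow 2).const_mul v).div_const 2)
      refine this.congr_deriv ?_
      simp
      ring
    have h1 := ((hasDerivAt_gaussMoment v k (m + v * t)).comp t hl).mul hq.exp
    refine h1.deriv.trans ?_
    rw [gaussMoment_succ]
    simp only [Function.comp]
    ring

lemma integral_pow_gaussianReal (m : ℝ) (v : NNReal) (k : ℕ) :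
    ∫ x, x ^ k ∂gaussianReal m v = gaussMoment v k m := by
  have h := iteratedDeriv_mgf_zero (X := id) (μ := gaussianReal m v) (by simp) k
  rw [mgf_id_gaussianReal, iteratedDeriv_exp_quadratic] at h
  simpa using h.symm

/-- A real function on `E` with finite absolute moments of all orders under `μ`. -/
def HasAllMoments {E : Type*} [MeasurableSpace E] (f : E → ℝ) (μ : Measure E) : Prop :=
  ∀ q : NNReal, MemLp f q μ

namespace HasAllMoments

variable {E : Type*} [MeasurableSpace E] {f g : E → ℝ} {μ : Measure E}

lemma integrable (hf : HasAllMoments f μ) : Integrable f μ := by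
  simpa [memLp_one_iff_integrable] using hf 1

lemma add (hf : HasAllMoments f μ) (hg : HasAllMoments g μ) :
    HasAllMoments (fun x => f x + g x) μ :=
  fun q => (hf q).add (hg q)

lemma sub (hf : HasAllMoments f μ) (hg : HasAllMoments g μ) :
    HasAllMoments (fun x => f x - g x) μ :=
  fun q => (hf q).sub (hg q)

lemma const [IsFiniteMeasure μ] (c : ℝ) : HasAllMoments (fun _ : E => c) μ :=
  fun _ => memLp_const c

lemma mul (hf : HasAllMoments f μ) (hg : HasAllMoments g μ) :
    HasAllMoments (fun x => f x * g x) μ := fun q => by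
  -- Hölder's inequality with 1/(2q) + 1/(2q) = 1/q.
  have : ENNReal.HolderTriple ((2 * q : NNReal) : ENNReal) ((2 * q : NNReal) : ENNReal) q := by
    refine ⟨?_⟩
    rw [ENNReal.coe_mul, ENNReal.mul_inv (by simp) (by simp), ← add_mul]
    simp [ENNReal.inv_two_add_inv_two]
  exact (hg (2 * q)).mul (hf (2 * q))

lemma const_mul [IsFiniteMeasure μ] (c : ℝ) (hf : HasAllMoments f μ) :
    HasAllMoments (fun x => c * f x) μ :=
  (const c).mul hf

lemma pow [IsFiniteMeasure μ] (hf : HasAllMoments f μ) (k : ℕ) :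
    HasAllMoments (fun x => f x ^ k) μ := by
  induction k with
  | zero => simpa using const (μ := μ) 1
  | succ k ih => simpa [pow_succ] using ih.mul hf

lemma add_measure {ν : Measure E} (h₁ : HasAllMoments f μ) (h₂ : HasAllMoments f ν) :
    HasAllMoments f (μ + ν) := fun q => by
  by_cases hq : q = 0
  · subst hq
    simpa using ((h₁ 0).1.add_measure (h₂ 0).1)
  have hq' : (q : ENNReal) ≠ 0 := by simpa using hq
  have hm := (h₁ q).1.add_measure (h₂ q).1
  rw [← integrable_norm_rpow_iff hm hq' (by simp)]
  exact ((h₁ q).integrable_norm_rpow hq' (by simp)).add_measure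
    ((h₂ q).integrable_norm_rpow hq' (by simp))

lemma smul_measure (h : HasAllMoments f μ) {c : ENNReal} (hc : c ≠ ⊤) :
    HasAllMoments f (c • μ) := fun q => (h q).smul_measure hc

end HasAllMoments

/-! ### Projections of multivariate Gaussian laws -/

section Gaussian

variable {p : ℕ}

local notation "E" => EuclideanSpace ℝ (Fin p)

lemma hasAllMoments_inner_multivariateGaussian (u μ : E) (S : Matrix (Fin p) (Fin p) ℝ) :
    HasAllMoments (fun x => inner ℝ u x) (multivariateGaussian μ S) := fun q =>
  (IsGaussian.memLp_id (multivariateGaussian μ S) q (by simp)).const_inner u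

lemma integral_inner_multivariateGaussian (u μ : E) (S : Matrix (Fin p) (Fin p) ℝ) :
    ∫ x, inner ℝ u x ∂multivariateGaussian μ S = inner ℝ u μ := by
  rw [integral_inner (IsGaussian.integrable_fun_id), integral_id_multivariateGaussian]

lemma covariance_inner_multivariateGaussian (u v μ : E) {S : Matrix (Fin p) (Fin p) ℝ}
    (hS : S.PosSemidef) :
    cov[fun x => inner ℝ u x, fun x => inner ℝ v x; multivariateGaussian μ S] =
      inner ℝ u (Matrix.toEuclideanCLM (𝕜 := ℝ) S v) := by
  rw [← covarianceBilin_apply_eq_cov IsGaussian.memLp_two_id,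
    covarianceBilin_multivariateGaussian hS, Matrix.inner_toEuclideanCLM]

lemma map_inner_multivariateGaussian (u μ : E) {S : Matrix (Fin p) (Fin p) ℝ}
    (hS : S.PosSemidef) :
    (multivariateGaussian μ S).map (fun x => inner ℝ u x) =
      gaussianReal (inner ℝ u μ)
        (inner ℝ u (Matrix.toEuclideanCLM (𝕜 := ℝ) S u)).toNNReal := by
  have h := IsGaussian.map_eq_gaussianReal (μ := multivariateGaussian μ S) (innerSL ℝ u)
  have e : ⇑(innerSL ℝ u) = fun x : E => inner ℝ u x := by ext; simp
  rw [e] at h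
  rw [h, ← covariance_self (by fun_prop), covariance_inner_multivariateGaussian _ _ _ hS]
  rw [integral_inner_multivariateGaussian]

lemma quadratic_nonneg {S : Matrix (Fin p) (Fin p) ℝ} (hS : S.PosSemidef) (u : E) :
    0 ≤ inner ℝ u (Matrix.toEuclideanCLM (𝕜 := ℝ) S u) := by
  rw [Matrix.inner_toEuclideanCLM]
  simpa using hS.dotProduct_mulVec_nonneg u.ofLp

lemma integral_inner_pow_multivariateGaussian (u μ : E) {S : Matrix (Fin p) (Fin p) ℝ}
    (hS : S.PosSemidef) (k : ℕ) :
    ∫ x, (inner ℝ u x) ^ k ∂multivariateGaussian μ S =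
      gaussMoment (inner ℝ u (Matrix.toEuclideanCLM (𝕜 := ℝ) S u)) k (inner ℝ u μ) := by
  have h := integral_pow_gaussianReal (inner ℝ u μ)
    (inner ℝ u (Matrix.toEuclideanCLM (𝕜 := ℝ) S u)).toNNReal k
  rw [← map_inner_multivariateGaussian u μ hS, integral_map (by fun_prop) (by fun_prop),
    Real.coe_toNNReal _ (quadratic_nonneg hS u)] at h
  exact h

/-- Under a Gaussian law, `⟪θ, x⟫` is independent of any linear image `A x` that is uncorrelated
with it. -/
lemma indepFun_inner_multivariateGaussian (θ μ : E) {S : Matrix (Fin p) (Fin p) ℝ}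
    (hS : S.PosSemidef) (A : E →L[ℝ] E)
    (hA : ∀ y, inner ℝ θ (Matrix.toEuclideanCLM (𝕜 := ℝ) S (A.adjoint y)) = 0) :
    IndepFun (fun x => inner ℝ θ x) (fun x => A x) (multivariateGaussian μ S) := by
  apply HasGaussianLaw.indepFun_of_covariance_inner
  · exact IsGaussian.hasGaussianLaw_id.map_fun ((innerSL ℝ θ).prod A)
  · intro c y
    have e1 : (fun x : E => inner ℝ c (inner ℝ θ x)) = fun x => inner ℝ (c • θ) x := by
      ext x; simp [inner_smul_left, mul_comm]
    have e2 : (fun x : E => inner ℝ y (A x)) = fun x => inner ℝ (A.adjoint y) x := by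
      ext x; rw [ContinuousLinearMap.adjoint_inner_left]
    rw [e1, e2, covariance_inner_multivariateGaussian _ _ _ hS, inner_smul_left, hA, mul_zero]

end Gaussian

/-! ### Moments and independence under the normal mixture -/

section Mixture

variable {p : ℕ}

local notation "E" => EuclideanSpace ℝ (Fin p)

lemma isProbabilityMeasure_normalMixture {α : ℝ} (h0 : 0 < α) (h1 : α < 1) (a b : E)
    (S : Matrix (Fin p) (Fin p) ℝ) : IsProbabilityMeasure (normalMixture α a b S) := by
  refine ⟨?_⟩
  simp only [normalMixture, Measure.add_apply, Measure.smul_apply, measure_univ, smul_eq_mul,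
    mul_one]
  rw [← ENNReal.ofReal_add h0.le (by linarith)]
  simp

lemma normalMixture_map_sub (α : ℝ) (a b c : E) (S : Matrix (Fin p) (Fin p) ℝ) :
    (normalMixture α a b S).map (fun x => x - c) = normalMixture α (a - c) (b - c) S := by
  have key : ∀ μ : E, (multivariateGaussian μ S).map (fun x => x - c) =
      multivariateGaussian (μ - c) S := by
    intro μ
    rw [multivariateGaussian, multivariateGaussian, Measure.map_map (by fun_prop) (by fun_prop)]
    congr 1
    ext1 x
    simp only [Function.comp]
    abel
  rw [normalMixture, Measure.map_add _ _ (by fun_prop), Measure.map_smul, Measure.map_smul,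
    key, key, normalMixture]

lemma HasAllMoments.normalMixture {f : E → ℝ} {α : ℝ} {a b : E} {S : Matrix (Fin p) (Fin p) ℝ}
    (ha : HasAllMoments f (multivariateGaussian a S))
    (hb : HasAllMoments f (multivariateGaussian b S)) :
    HasAllMoments f (normalMixture α a b S) :=
  (ha.smul_measure ENNReal.ofReal_ne_top).add_measure (hb.smul_measure ENNReal.ofReal_ne_top)

lemma hasAllMoments_inner_normalMixture (u : E) (α : ℝ) (a b : E)
    (S : Matrix (Fin p) (Fin p) ℝ) :
    HasAllMoments (fun x => inner ℝ u x) (normalMixture α a b S) :=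
  .normalMixture (hasAllMoments_inner_multivariateGaussian _ _ _)
    (hasAllMoments_inner_multivariateGaussian _ _ _)

lemma integral_normalMixture {α : ℝ} (h0 : 0 < α) (h1 : α < 1) {a b : E}
    {S : Matrix (Fin p) (Fin p) ℝ} {f : E → ℝ}
    (ha : Integrable f (multivariateGaussian a S)) (hb : Integrable f (multivariateGaussian b S)) :
    ∫ x, f x ∂normalMixture α a b S =
      α * ∫ x, f x ∂multivariateGaussian a S + (1 - α) * ∫ x, f x ∂multivariateGaussian b S := by
  rw [normalMixture, integral_add_measure (ha.smul_measure ENNReal.ofReal_ne_top)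
    (hb.smul_measure ENNReal.ofReal_ne_top), integral_smul_measure, integral_smul_measure,
    ENNReal.toReal_ofReal h0.le, ENNReal.toReal_ofReal (by linarith)]
  simp

lemma integral_inner_pow_normalMixture {α : ℝ} (h0 : 0 < α) (h1 : α < 1) (a b u : E)
    {S : Matrix (Fin p) (Fin p) ℝ} (hS : S.PosSemidef) (k : ℕ) :
    ∫ x, (inner ℝ u x) ^ k ∂normalMixture α a b S =
      α * gaussMoment (inner ℝ u (Matrix.toEuclideanCLM (𝕜 := ℝ) S u)) k (inner ℝ u a) +
      (1 - α) * gaussMoment (inner ℝ u (Matrix.toEuclideanCLM (𝕜 := ℝ) S u)) k (inner ℝ u b) := by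
  rw [integral_normalMixture h0 h1, integral_inner_pow_multivariateGaussian _ _ hS,
    integral_inner_pow_multivariateGaussian _ _ hS]
  · exact ((hasAllMoments_inner_multivariateGaussian u a S).pow k).integrable
  · exact ((hasAllMoments_inner_multivariateGaussian u b S).pow k).integrable

/-- Symmetry of S is inherited from the symmetry of the covariance of the Gaussian law that it
defines. -/
lemma toEuclideanCLM_symm {S : Matrix (Fin p) (Fin p) ℝ} (hS : S.PosSemidef) (u v : E) :
    inner ℝ u (Matrix.toEuclideanCLM (𝕜 := ℝ) S v) =
      inner ℝ (Matrix.toEuclideanCLM (𝕜 := ℝ) S u) v := by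
  rw [← covariance_inner_multivariateGaussian u v 0 hS, covariance_comm,
    covariance_inner_multivariateGaussian v u 0 hS, real_inner_comm]

/-- Under a Gaussian law with mean parallel to `S θ`, the projections on directions orthogonal to
`S θ` are centered and independent of `⟪θ, ·⟫`. -/
lemma integral_mul_multivariateGaussian {S : Matrix (Fin p) (Fin p) ℝ} (hS : S.PosSemidef)
    {θ h : E} (hθ : Matrix.toEuclideanCLM (𝕜 := ℝ) S θ = h) (hτ : 0 < (inner ℝ θ h : ℝ))
    (c : ℝ) {f : ℝ → ℝ} (hf : Continuous f) {d b : E} (hd : inner ℝ d h = (0 : ℝ))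
    (hb : inner ℝ b h = (0 : ℝ)) :
    (∫ y, f (inner ℝ θ y) * inner ℝ d y ∂multivariateGaussian (c • h) S = 0) ∧
    (∫ y, f (inner ℝ θ y) * (inner ℝ d y * inner ℝ b y) ∂multivariateGaussian (c • h) S =
      (∫ y, f (inner ℝ θ y) ∂multivariateGaussian (c • h) S) *
        inner ℝ d (Matrix.toEuclideanCLM (𝕜 := ℝ) S b)) := by
  -- A is the projection along h that removes the regression on ⟪θ, ·⟫. It kills h = Sθ, hence is
  -- uncorrelated with ⟪θ, ·⟫, and it does not change inner products with vectors orthogonal to h.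
  set A : E →L[ℝ] E :=
    ContinuousLinearMap.id ℝ E - (inner ℝ θ h : ℝ)⁻¹ • (innerSL ℝ θ).smulRight h with hA
  have hAy : ∀ y, A y = y - ((inner ℝ θ h : ℝ)⁻¹ * inner ℝ θ y) • h := by
    intro y; simp [hA, smul_smul]
  have hAh : A h = 0 := by
    rw [hAy, inv_mul_cancel₀ hτ.ne', one_smul, sub_self]
  have hproj : ∀ e : E, inner ℝ e h = (0 : ℝ) → ∀ y, inner ℝ e (A y) = (inner ℝ e y : ℝ) := by
    intro e he y
    rw [hAy, inner_sub_right, inner_smul_right, he, mul_zero, sub_zero]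
  have hind := indepFun_inner_multivariateGaussian θ (c • h) hS A (fun y => by
    rw [toEuclideanCLM_symm hS, hθ, ContinuousLinearMap.adjoint_inner_right, hAh, inner_zero_left])
  have hmean : ∀ e : E, inner ℝ e h = (0 : ℝ) →
      ∫ y, (inner ℝ e y : ℝ) ∂multivariateGaussian (c • h) S = 0 := by
    intro e he
    rw [integral_inner_multivariateGaussian, inner_smul_right, he, mul_zero]
  constructor
  · have h1 := (hind.comp hf.measurable
      (measurable_const.inner measurable_id : Measurable fun y : E => (inner ℝ d y : ℝ)))
    have h2 := h1.integral_fun_mul_eq_mul_integral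
      (Continuous.aestronglyMeasurable (by simp only [Function.comp_def]; fun_prop))
      (Continuous.aestronglyMeasurable (by simp only [Function.comp_def]; fun_prop))
    simp only [Function.comp_def, hproj d hd] at h2
    rw [h2, hmean d hd, mul_zero]
  · have h1 := (hind.comp hf.measurable
      (by fun_prop : Measurable fun y : E => (inner ℝ d y : ℝ) * (inner ℝ b y : ℝ)))
    have h2 := h1.integral_fun_mul_eq_mul_integral
      (Continuous.aestronglyMeasurable (by simp only [Function.comp_def]; fun_prop))
      (Continuous.aestronglyMeasurable (by simp only [Function.comp_def]; fun_prop))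
    simp only [Function.comp_def, hproj d hd, hproj b hb] at h2
    rw [h2]
    congr 1
    have h3 := covariance_inner_multivariateGaussian d b (c • h) hS
    rw [covariance_eq_sub ((hasAllMoments_inner_multivariateGaussian d _ S) 2)
      ((hasAllMoments_inner_multivariateGaussian b _ S) 2), hmean d hd, hmean b hb] at h3
    simpa using h3

/-- Both components have means along h and the same S, so the residual factor is common to them and
comes out of the mixture; only the factor in ⟪θ, ·⟫ is averaged. -/
lemma integral_mul_normalMixture {α : ℝ} (h0 : 0 < α) (h1 : α < 1)
    {S : Matrix (Fin p) (Fin p) ℝ} (hS : S.PosSemidef)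
    {θ h : E} (hθ : Matrix.toEuclideanCLM (𝕜 := ℝ) S θ = h) (hτ : 0 < (inner ℝ θ h : ℝ))
    (c c' : ℝ) {f : ℝ → ℝ} (hf : Continuous f)
    (hf' : ∀ μ, HasAllMoments (fun y => f (inner ℝ θ y)) (multivariateGaussian μ S))
    {d b : E} (hd : inner ℝ d h = (0 : ℝ)) (hb : inner ℝ b h = (0 : ℝ)) :
    (∫ y, f (inner ℝ θ y) * inner ℝ d y ∂normalMixture α (c • h) (c' • h) S = 0) ∧
    (∫ y, f (inner ℝ θ y) * (inner ℝ d y * inner ℝ b y) ∂normalMixture α (c • h) (c' • h) S =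
      (∫ y, f (inner ℝ θ y) ∂normalMixture α (c • h) (c' • h) S) *
        inner ℝ d (Matrix.toEuclideanCLM (𝕜 := ℝ) S b)) := by
  have A1 := integral_mul_multivariateGaussian hS hθ hτ c hf hd hb
  have A2 := integral_mul_multivariateGaussian hS hθ hτ c' hf hd hb
  have hi := fun u μ => hasAllMoments_inner_multivariateGaussian (p := p) u μ S
  constructor
  · rw [integral_normalMixture h0 h1 ((hf' _).mul (hi _ _)).integrable
      ((hf' _).mul (hi _ _)).integrable, A1.1, A2.1]
    simp
  · rw [integral_normalMixture h0 h1 ((hf' _).mul ((hi _ _).mul (hi _ _))).integrable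
      ((hf' _).mul ((hi _ _).mul (hi _ _))).integrable, A1.2, A2.2,
      integral_normalMixture h0 h1 (hf' _).integrable (hf' _).integrable]
    ring

end Mixture

/-! ### One strong law for all fourth-order moments -/

section SLLN

variable {p : ℕ}

local notation "E" => EuclideanSpace ℝ (Fin p)

/-- The average of `f` over the first `n` terms of `y`. -/
def avg {F : Type*} (y : ℕ → F) (n : ℕ) (f : F → ℝ) : ℝ :=
  (n : ℝ)⁻¹ * ∑ i ∈ Finset.range n, f (y i)

/-- The affine functional `y ↦ a.2 + ⟪a.1, y⟫`. -/
def affine (a : E × ℝ) (y : E) : ℝ := a.2 + inner ℝ a.1 y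

/-- The empirical averages of products of four affine functionals along `y` converge to the
integrals against `ν`, continuously in the functionals. -/
def MomentsConverge (y : ℕ → E) (ν : Measure E) : Prop :=
  ∀ l : Filter ℕ, l ≤ atTop → ∀ (a : Fin 4 → ℕ → E × ℝ) (a₀ : Fin 4 → E × ℝ),
    (∀ j, Tendsto (a j) l (𝓝 (a₀ j))) →
    Tendsto (fun n => avg y n fun z => ∏ j, affine (a j n) z) l
      (𝓝 (∫ z, ∏ j, affine (a₀ j) z ∂ν))

/-- Evaluation of affine functionals at `y`. -/
def affineEval (y : E) : (E × ℝ) →L[ℝ] ℝ :=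
  ContinuousLinearMap.snd ℝ E ℝ + (innerSL ℝ y).comp (ContinuousLinearMap.fst ℝ E ℝ)

lemma affineEval_apply (y : E) (a : E × ℝ) : affineEval y a = affine a y := by
  simp [affineEval, affine, real_inner_comm]

lemma continuous_affineEval : Continuous (affineEval : E → (E × ℝ) →L[ℝ] ℝ) := by
  unfold affineEval
  fun_prop

/-- The fourth tensor power of the evaluation at `y`. -/
def affineTensor (y : E) : ContinuousMultilinearMap ℝ (fun _ : Fin 4 => E × ℝ) ℝ :=
  (ContinuousMultilinearMap.mkPiAlgebra ℝ (Fin 4) ℝ).compContinuousLinearMap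
    (fun _ => affineEval y)

lemma affineTensor_apply (y : E) (a : Fin 4 → E × ℝ) :
    affineTensor y a = ∏ j, affine (a j) y := by
  simp [affineTensor, affineEval_apply]

lemma continuous_affineTensor :
    Continuous (affineTensor : E → ContinuousMultilinearMap ℝ (fun _ : Fin 4 => E × ℝ) ℝ) := by
  have h : (affineTensor : E → _) = fun y =>
      ContinuousMultilinearMap.compContinuousLinearMapContinuousMultilinear ℝ
        (fun _ : Fin 4 => E × ℝ) (fun _ => ℝ) ℝ (fun _ => affineEval y)
        (ContinuousMultilinearMap.mkPiAlgebra ℝ (Fin 4) ℝ) := by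
    ext y; rfl
  rw [h]
  have h2 : Continuous fun y : E => (fun _ : Fin 4 => affineEval y) :=
    continuous_pi fun _ => continuous_affineEval
  exact ((ContinuousMultilinearMap.compContinuousLinearMapContinuousMultilinear ℝ
        (fun _ : Fin 4 => E × ℝ) (fun _ => ℝ) ℝ).cont.comp h2).clm_apply continuous_const

lemma norm_affineTensor_le (y : E) : ‖affineTensor y‖ ≤ (1 + ‖y‖) ^ 4 := by
  have h1 : ‖affineEval y‖ ≤ 1 + ‖y‖ := by
    refine ContinuousLinearMap.opNorm_le_bound _ (by positivity) fun a => ?_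
    rw [affineEval_apply, affine]
    have h2 := norm_inner_le_norm (𝕜 := ℝ) a.1 y
    have h3 := norm_fst_le a
    have h4 := norm_snd_le a
    calc ‖a.2 + inner ℝ a.1 y‖ ≤ ‖a.2‖ + ‖(inner ℝ a.1 y : ℝ)‖ := norm_add_le _ _
      _ ≤ ‖a‖ + ‖a‖ * ‖y‖ := by gcongr; exact h2.trans (by gcongr)
      _ = _ := by ring
  refine (ContinuousMultilinearMap.norm_compContinuousLinearMap_le _ _).trans ?_
  simp only [ContinuousMultilinearMap.norm_mkPiAlgebra, one_mul, Finset.prod_const,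
    Finset.card_univ, Fintype.card_fin]
  gcongr

/-- The strong law is applied once, in the finite-dimensional space of 4-linear forms, to the fourth
tensor power of the evaluation at y i. A single null set thus serves all functionals, and joint
continuity of evaluation allows the functionals to vary with n. -/
lemma ae_momentsConverge {Ω : Type*} [MeasurableSpace Ω] {P : Measure Ω} [IsProbabilityMeasure P]
    {ν : Measure E} (y : ℕ → Ω → E) (hlaw : ∀ i, HasLaw (y i) ν P) (hind : iIndepFun y P)
    (hint : Integrable (fun z => (1 + ‖z‖) ^ 4) ν) :
    ∀ᵐ ω ∂P, MomentsConverge (fun i => y i ω) ν := by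
  let _ : MeasurableSpace (ContinuousMultilinearMap ℝ (fun _ : Fin 4 => E × ℝ) ℝ) := borel _
  have _ : BorelSpace (ContinuousMultilinearMap ℝ (fun _ : Fin 4 => E × ℝ) ℝ) := ⟨rfl⟩
  have hmeas := (continuous_affineTensor (p := p)).measurable
  have hintν : Integrable (affineTensor : E → _) ν :=
    hint.mono' continuous_affineTensor.aestronglyMeasurable
      (Eventually.of_forall norm_affineTensor_le)
  have hid : ∀ i, IdentDistrib (y i) (y 0) P P := fun i => (hlaw i).identDistrib (hlaw 0)
  have hE : ∫ ω, affineTensor (y 0 ω) ∂P = ∫ z, affineTensor z ∂ν :=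
    (hlaw 0).integral_comp continuous_affineTensor.aestronglyMeasurable
  have h := strong_law_ae (μ := P) (fun i ω => affineTensor (y i ω))
    (by
      rw [← (hlaw 0).map_eq] at hintν
      exact hintν.comp_aemeasurable (hlaw 0).aemeasurable)
    (fun i j hij => (hind.indepFun hij).comp hmeas hmeas)
    (fun i => (hid i).comp hmeas)
  filter_upwards [h] with ω hω
  intro l hl a a₀ ha
  rw [hE] at hω
  have h1 : Tendsto (fun n j => a j n) l (𝓝 a₀) := tendsto_pi_nhds.2 ha
  have h2 := (continuous_eval (F := ContinuousMultilinearMap ℝ (fun _ : Fin 4 => E × ℝ) ℝ)).tendsto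
    (∫ z, affineTensor z ∂ν, a₀) |>.comp ((hω.mono_left hl).prodMk_nhds h1)
  have h3 : (∫ z, affineTensor z ∂ν) a₀ = ∫ z, ∏ j, affine (a₀ j) z ∂ν := by
    have := (ContinuousMultilinearMap.apply ℝ (fun _ : Fin 4 => E × ℝ) ℝ a₀).integral_comp_comm
      hintν
    simp only [ContinuousMultilinearMap.apply_apply, affineTensor_apply] at this
    exact this.symm
  simp only [h3] at h2
  refine h2.congr fun n => ?_
  simp [avg, affineTensor_apply]

end SLLN

/-! ### Central limit theorem and negligible remainders -/

section CLT

variable {Ω : Type*} [MeasurableSpace Ω] {P : Measure Ω} [IsProbabilityMeasure P]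

lemma charFun_map_inner {F : Type*} [NormedAddCommGroup F] [InnerProductSpace ℝ F]
    [MeasurableSpace F] [BorelSpace F] (μ : Measure F) (t : F) :
    charFun (μ.map fun x => (inner ℝ t x : ℝ)) 1 = charFun μ t := by
  rw [charFun_apply, charFun_apply, integral_map (by fun_prop) (by fun_prop)]
  simp [real_inner_comm]

/-- **Multivariate central limit theorem.** -/
theorem tendstoInDistribution_inv_sqrt_smul_sum {F : Type*} [NormedAddCommGroup F]
    [InnerProductSpace ℝ F] [FiniteDimensional ℝ F] [MeasurableSpace F] [BorelSpace F]
    {ξ : ℕ → Ω → F} (hind : iIndepFun ξ P) (hid : ∀ i, IdentDistrib (ξ i) (ξ 0) P P)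
    (hξ : ∀ t, MemLp (fun ω => (inner ℝ t (ξ 0 ω) : ℝ)) 2 P)
    (h0 : ∀ t, ∫ ω, (inner ℝ t (ξ 0 ω) : ℝ) ∂P = 0) {G : Measure F} [IsProbabilityMeasure G]
    (hG : ∀ t, G.map (fun x => (inner ℝ t x : ℝ)) =
      gaussianReal 0 (Var[fun ω => (inner ℝ t (ξ 0 ω) : ℝ); P]).toNNReal) :
    TendstoInDistribution (fun (n : ℕ) ω => (√(n : ℝ))⁻¹ • ∑ i ∈ Finset.range n, ξ i ω) atTop
      (id : F → F) (fun _ => P) G := by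
  have hm : ∀ n : ℕ, AEMeasurable (fun ω => (√(n : ℝ))⁻¹ • ∑ i ∈ Finset.range n, ξ i ω) P :=
    fun n => (Finset.aemeasurable_fun_sum _ fun i _ => (hid i).aemeasurable_fst).const_smul _
  refine ⟨hm, by fun_prop, ?_⟩
  refine ProbabilityMeasure.tendsto_iff_tendsto_charFun.2 fun t => ?_
  have hinner : Measurable fun x : F => (inner ℝ t x : ℝ) := by fun_prop
  -- Cramér-Wold: the scalar theorem is used for ⟪t, ξ i⟫, whose characteristic function at 1 is
  -- that of ξ i at t.
  have h1 := tendstoInDistribution_inv_sqrt_mul_sum_sub (P := P) (P' := G)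
    (X := fun i ω => (inner ℝ t (ξ i ω) : ℝ)) (Y := fun x => (inner ℝ t x : ℝ))
    ⟨hinner.aemeasurable, hG t⟩ (hξ t)
    (hind.comp (fun _ x => (inner ℝ t x : ℝ)) fun _ => hinner) (fun i => (hid i).comp hinner)
  have h2 := ProbabilityMeasure.tendsto_iff_tendsto_charFun.1 h1.tendsto 1
  simp only [ProbabilityMeasure.coe_mk, charFun_map_inner, Measure.map_id, h0, mul_zero,
    sub_zero] at h2 ⊢
  refine h2.congr fun n => ?_
  rw [← charFun_map_inner (P.map _) t, AEMeasurable.map_map_of_aemeasurable (by fun_prop) (hm n)]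
  congr 2
  ext ω
  simp [inner_smul_right, inner_sum]

/-- Tightness by Chebyshev: the variance of the normalized sum is at most that of one term,
uniformly in n. -/
lemma exists_forall_measure_abs_sum_ge_le {X : ℕ → Ω → ℝ} (hind : iIndepFun X P)
    (hid : ∀ i, IdentDistrib (X i) (X 0) P P) (hX : MemLp (X 0) 2 P) (h0 : P[X 0] = 0)
    {ε : ENNReal} (hε : 0 < ε) :
    ∃ K : ℝ, 0 < K ∧ ∀ n : ℕ, P {ω | K ≤ |(√(n : ℝ))⁻¹ * ∑ i ∈ Finset.range n, X i ω|} ≤ ε := by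
  have hL : ∀ i, MemLp (X i) 2 P := fun i => (hid i).memLp_iff.2 hX
  set V := Var[X 0; P]
  have hV : 0 ≤ V := variance_nonneg _ _
  obtain ⟨K, hK, hKε⟩ : ∃ K : ℝ, 0 < K ∧ ENNReal.ofReal (V / K ^ 2) ≤ ε := by
    have h1 : Tendsto (fun K : ℝ => ENNReal.ofReal (V / K ^ 2)) atTop (𝓝 0) := by
      rw [← ENNReal.ofReal_zero]
      exact (ENNReal.continuous_ofReal.tendsto 0).comp
        (tendsto_const_nhds.div_atTop (tendsto_pow_atTop two_ne_zero))
    obtain ⟨K, h2, h3⟩ := ((eventually_gt_atTop (0 : ℝ)).and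
      (h1.eventually (Iic_mem_nhds hε))).exists
    exact ⟨K, h2, h3⟩
  refine ⟨K, hK, fun n => le_trans ?_ hKε⟩
  set Z : Ω → ℝ := fun ω => (√(n : ℝ))⁻¹ * ∑ i ∈ Finset.range n, X i ω
  have hZ : MemLp Z 2 P := (memLp_finsetSum _ fun i _ => hL i).const_mul _
  have hZ0 : ∫ ω, Z ω ∂P = 0 := by
    simp only [Z]
    rw [integral_const_mul, integral_finsetSum _ fun i _ => (hL i).integrable (by norm_num)]
    simp [fun i => (hid i).integral_eq, h0]
  have hvar : Var[Z; P] ≤ V := by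
    have h1 := IndepFun.variance_sum (s := Finset.range n) (fun i _ => hL i)
      (fun i _ j _ hij => hind.indepFun hij)
    have h2 : (∑ i ∈ Finset.range n, X i) = fun ω => ∑ i ∈ Finset.range n, X i ω := by
      ext; simp
    rw [h2] at h1
    simp only [Z]
    rw [variance_const_mul, h1, Finset.sum_congr rfl fun i _ => (hid i).variance_eq]
    rcases Nat.eq_zero_or_pos n with rfl | hn
    · simpa using hV
    · have : (0 : ℝ) < n := by exact_mod_cast hn
      simp only [Finset.sum_const, Finset.card_range, nsmul_eq_mul, inv_pow, Real.sq_sqrt this.le]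
      rw [inv_mul_cancel_left₀ this.ne']
  have h3 := meas_ge_le_variance_div_sq hZ hK
  simp only [hZ0, sub_zero] at h3
  exact h3.trans (ENNReal.ofReal_le_ofReal (by gcongr))

/-- A remainder which is almost surely negligible with respect to centered empirical averages is
negligible in probability after multiplication by `√n`. -/
lemma tendstoInMeasure_sqrt_smul_of_isLittleO {F : Type*} [NormedAddCommGroup F] [NormedSpace ℝ F]
    [MeasurableSpace F] [BorelSpace F] [SecondCountableTopology F]
    {ι : Type*} [Fintype ι] {X : ι → ℕ → Ω → ℝ} (hind : ∀ j, iIndepFun (X j) P)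
    (hid : ∀ j i, IdentDistrib (X j i) (X j 0) P P) (hX : ∀ j, MemLp (X j 0) 2 P)
    (h0 : ∀ j, P[X j 0] = 0) {R : ℕ → Ω → F} (hR : ∀ n, AEMeasurable (R n) P)
    (hRo : ∀ᵐ ω ∂P, (fun n => R n ω) =o[atTop]
      fun n : ℕ => ∑ j, |(n : ℝ)⁻¹ * ∑ i ∈ Finset.range n, X j i ω|) :
    TendstoInMeasure P (fun (n : ℕ) ω => √(n : ℝ) • R n ω) atTop 0 := by
  set T : ι → ℕ → Ω → ℝ := fun j n ω => (√(n : ℝ))⁻¹ * ∑ i ∈ Finset.range n, X j i ω with hT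
  -- Dividing by 1 plus the normalized sums gives a quantity that tends to 0 almost surely, hence in
  -- probability; tightness of the denominator then removes it.
  set N : ℕ → Ω → ℝ := fun n ω => ‖√(n : ℝ) • R n ω‖ / (1 + ∑ j, |T j n ω|) with hN
  have hTm : ∀ j n, AEMeasurable (T j n) P := fun j n =>
    (Finset.aemeasurable_fun_sum _ fun i _ => (hid j i).aemeasurable_fst).const_mul _
  have hNm : ∀ n, AEMeasurable (N n) P := fun n =>
    ((hR n).const_smul _).norm.div
      ((Finset.aemeasurable_fun_sum _ fun j _ => (hTm j n).norm).const_add 1)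
  have hN0 : TendstoInMeasure P N atTop (fun _ => (0 : ℝ)) := by
    refine tendstoInMeasure_of_tendsto_ae (fun n => (hNm n).aestronglyMeasurable) ?_
    filter_upwards [hRo] with ω hω
    refine squeeze_zero_norm' (a := fun n => ‖R n ω‖ /
      ‖∑ j, |(n : ℝ)⁻¹ * ∑ i ∈ Finset.range n, X j i ω|‖) ?_ ?_
    · filter_upwards [eventually_gt_atTop 0, hω.def one_pos] with n hn hb
      have hn' : (0 : ℝ) < √(n : ℝ) := Real.sqrt_pos.2 (by exact_mod_cast hn)
      have e : ∑ j, |(n : ℝ)⁻¹ * ∑ i ∈ Finset.range n, X j i ω| =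
          (√(n : ℝ))⁻¹ * ∑ j, |T j n ω| := by
        rw [Finset.mul_sum]
        refine Finset.sum_congr rfl fun j _ => ?_
        simp only [hT]
        rw [abs_mul, abs_mul, abs_of_pos (inv_pos.2 hn'), ← mul_assoc, ← mul_inv,
          Real.mul_self_sqrt (Nat.cast_nonneg n), abs_of_nonneg (by positivity)]
      rw [e] at hb ⊢
      have hs : 0 ≤ ∑ j, |T j n ω| := Finset.sum_nonneg fun _ _ => abs_nonneg _
      have hs' : 0 ≤ (√(n : ℝ))⁻¹ * ∑ j, |T j n ω| := by positivity
      have hNn : ‖N n ω‖ = √(n : ℝ) * ‖R n ω‖ / (1 + ∑ j, |T j n ω|) := by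
        simp only [hN]
        rw [Real.norm_of_nonneg (by positivity), norm_smul, Real.norm_of_nonneg hn'.le]
      rw [Real.norm_of_nonneg hs'] at hb ⊢
      rw [hNn]
      -- When the comparison sum is zero, the little-o bound forces R n ω = 0.
      rcases hs.eq_or_lt with hz | hz
      · rw [← hz] at hb ⊢
        have : ‖R n ω‖ = 0 := le_antisymm (by simpa using hb) (norm_nonneg _)
        simp [this]
      · rw [div_le_div_iff₀ (by positivity) (by positivity)]
        have : √(n : ℝ) * ‖R n ω‖ * ((√(n : ℝ))⁻¹ * ∑ j, |T j n ω|) =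
            ‖R n ω‖ * ∑ j, |T j n ω| := by field_simp
        rw [this]
        gcongr
        linarith
    · exact (Asymptotics.isLittleO_iff_tendsto' (by
        filter_upwards [hω.norm_norm.def one_pos] with n hn hz
        rw [norm_norm] at hn
        rw [hz, norm_zero, mul_zero] at hn
        exact le_antisymm hn (norm_nonneg _))).1 hω.norm_norm
  rw [tendstoInMeasure_iff_norm] at hN0 ⊢
  intro ε hε
  rw [ENNReal.tendsto_nhds_zero]
  intro η hη
  have hη2 : 0 < η / 2 := ENNReal.half_pos hη.ne'
  -- The budget η / 2 is shared among the index set; adding 1 keeps the divisor nonzero when that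
  -- set is empty.
  set c : ENNReal := (Fintype.card ι : ENNReal) + 1 with hc
  have hc0 : c ≠ 0 := by simp [hc]
  have hct : c ≠ ⊤ := by simp [hc]
  have hηc : 0 < η / 2 / c := ENNReal.div_pos hη2.ne' hct
  choose K hK0 hK using fun j =>
    exists_forall_measure_abs_sum_ge_le (hind j) (hid j) (hX j) (h0 j) hηc
  have hden : 0 < 1 + ∑ j, K j := by
    have := Finset.sum_nonneg (s := Finset.univ) fun j _ => (hK0 j).le
    linarith
  filter_upwards [ENNReal.tendsto_nhds_zero.1 (hN0 (ε / (1 + ∑ j, K j)) (by positivity))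
    (η / 2) hη2] with n hn
  have hsub : {ω | ε ≤ ‖√(n : ℝ) • R n ω - (0 : Ω → F) ω‖} ⊆
      {ω | ε / (1 + ∑ j, K j) ≤ ‖N n ω - 0‖} ∪ ⋃ j ∈ (Finset.univ : Finset ι),
        {ω | K j ≤ |T j n ω|} := by
    intro ω hω
    simp only [Set.mem_union, Set.mem_ofPred_eq, Set.mem_iUnion, Pi.zero_apply, sub_zero] at hω ⊢
    by_contra! hcon
    obtain ⟨h1, h2⟩ := hcon
    have hs : ∑ j, |T j n ω| ≤ ∑ j, K j := Finset.sum_le_sum fun j hj => (h2 j hj).le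
    have hs0 : 0 ≤ ∑ j, |T j n ω| := Finset.sum_nonneg fun _ _ => abs_nonneg _
    rw [Real.norm_of_nonneg (by positivity)] at h1
    simp only [hN] at h1
    have h3 : ε / (1 + ∑ j, K j) ≤ ‖√(n : ℝ) • R n ω‖ / (1 + ∑ j, |T j n ω|) := by
      gcongr
    exact absurd h1 (not_lt.2 h3)
  calc P _ ≤ _ := measure_mono hsub
    _ ≤ P {ω | ε / (1 + ∑ j, K j) ≤ ‖N n ω - 0‖} +
        P (⋃ j ∈ (Finset.univ : Finset ι), {ω | K j ≤ |T j n ω|}) := measure_union_le _ _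
    _ ≤ η / 2 + ∑ j : ι, η / 2 / c := by
        refine add_le_add hn ((measure_biUnion_finset_le _ _).trans
          (Finset.sum_le_sum fun j _ => hK j n))
    _ ≤ η / 2 + η / 2 := by
        gcongr
        rw [Finset.sum_const, Finset.card_univ, nsmul_eq_mul]
        calc (Fintype.card ι : ENNReal) * (η / 2 / c) ≤ c * (η / 2 / c) := by
              gcongr; simp [hc]
          _ = η / 2 := ENNReal.mul_div_cancel hc0 hct
    _ = η := ENNReal.add_halves η

end CLT

/-! ### Invariances of the index and consistency of maximizers -/

section Consistency

variable {p : ℕ}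

local notation "E" => EuclideanSpace ℝ (Fin p)

lemma sampleMean_sub_const (x : ℕ → E) (c : E) {n : ℕ} (hn : 0 < n) :
    sampleMean (fun i => x i - c) n = sampleMean x n - c := by
  have : (n : ℝ) ≠ 0 := by exact_mod_cast hn.ne'
  simp [sampleMean, Finset.sum_sub_distrib, smul_sub, ← Nat.cast_smul_eq_nsmul ℝ, smul_smul, this]

lemma sampleMoment_sub_const (x : ℕ → E) (c : E) (n k : ℕ) (u : E) :
    sampleMoment (fun i => x i - c) n k u = sampleMoment x n k u := by
  rcases Nat.eq_zero_or_pos n with rfl | hn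
  · simp [sampleMoment]
  · simp [sampleMoment, sampleMean_sub_const x c hn]

lemma hybridIndex_sub_const (w₁ w₂ : ℝ) (x : ℕ → E) (c : E) (n : ℕ) :
    hybridIndex w₁ w₂ (fun i => x i - c) n = hybridIndex w₁ w₂ x n := by
  ext u
  simp [hybridIndex, sampleSkewness, sampleKurtosis, sampleMoment_sub_const]

lemma sampleMoment_smul (x : ℕ → E) (n k : ℕ) (c : ℝ) (u : E) :
    sampleMoment x n k (c • u) = c ^ k * sampleMoment x n k u := by
  simp only [sampleMoment, inner_smul_left, mul_pow, ← Finset.mul_sum]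
  simp
  ring

lemma sampleMoment_two_nonneg (x : ℕ → E) (n : ℕ) (u : E) : 0 ≤ sampleMoment x n 2 u :=
  mul_nonneg (by positivity) (Finset.sum_nonneg fun _ _ => sq_nonneg _)

/-- The hybrid index as a function of the second, third and fourth moments. -/
def indexOfMoments (w₁ w₂ a b c : ℝ) : ℝ := w₁ * (b ^ 2 / a ^ 3) + w₂ * (c / a ^ 2 - 3) ^ 2

/-- Squaring the skewness turns the power 3/2 into a cube, so the index is a rational function of
the moments. -/
lemma hybridIndex_eq (w₁ w₂ : ℝ) (x : ℕ → E) (n : ℕ) (u : E) :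
    hybridIndex w₁ w₂ x n u = indexOfMoments w₁ w₂ (sampleMoment x n 2 u)
      (sampleMoment x n 3 u) (sampleMoment x n 4 u) := by
  have h := sampleMoment_two_nonneg x n u
  have h2 : ((sampleMoment x n 2 u) ^ (3 / 2 : ℝ)) ^ 2 = sampleMoment x n 2 u ^ 3 := by
    rw [← Real.rpow_natCast, ← Real.rpow_mul h, ← Real.rpow_natCast]
    norm_num
  simp [hybridIndex, sampleSkewness, sampleKurtosis, indexOfMoments, div_pow, h2]

lemma indexOfMoments_scale (w₁ w₂ a b c : ℝ) {r : ℝ} (hr : r ≠ 0) :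
    indexOfMoments w₁ w₂ (r ^ 2 * a) (r ^ 3 * b) (r ^ 4 * c) = indexOfMoments w₁ w₂ a b c := by
  unfold indexOfMoments
  rw [mul_pow, mul_pow, mul_pow, ← pow_mul, ← pow_mul, ← pow_mul,
    mul_div_mul_left _ _ (pow_ne_zero _ hr), mul_div_mul_left _ _ (pow_ne_zero _ hr)]

/-- Invariance under nonzero scalars covers the sign ambiguity and turns the constrained
maximization on the sphere into an unconstrained one. -/
lemma hybridIndex_smul (w₁ w₂ : ℝ) (x : ℕ → E) (n : ℕ) {r : ℝ} (hr : r ≠ 0) (u : E) :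
    hybridIndex w₁ w₂ x n (r • u) = hybridIndex w₁ w₂ x n u := by
  simp only [hybridIndex_eq, sampleMoment_smul, indexOfMoments_scale w₁ w₂ _ _ _ hr]

lemma IsSphereMaximizer.le_of_ne_zero {w₁ w₂ : ℝ} {x : ℕ → E} {n : ℕ} {u : E}
    (hu : IsSphereMaximizer (hybridIndex w₁ w₂ x n) u) {v : E} (hv : v ≠ 0) :
    hybridIndex w₁ w₂ x n v ≤ hybridIndex w₁ w₂ x n u := by
  have hv' : ‖v‖⁻¹ ≠ 0 := inv_ne_zero (norm_ne_zero_iff.2 hv)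
  rw [← hybridIndex_smul w₁ w₂ x n hv' v]
  exact hu.2 (by simp [norm_smul, hv])

lemma IsSphereMaximizer.smul_sign {w₁ w₂ : ℝ} {x : ℕ → E} {n : ℕ} {u : E}
    (hu : IsSphereMaximizer (hybridIndex w₁ w₂ x n) u) {s : ℝ} (hs : s = -1 ∨ s = 1) :
    IsSphereMaximizer (hybridIndex w₁ w₂ x n) (s • u) := by
  have h1 : |s| = 1 := by rcases hs with rfl | rfl <;> simp
  have h0 : s ≠ 0 := by rintro rfl; simp at h1
  refine ⟨?_, fun v hv => ?_⟩
  · have := hu.1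
    simp only [mem_sphere_zero_iff_norm] at this ⊢
    rw [norm_smul, this, Real.norm_eq_abs, h1, one_mul]
  · rw [Set.mem_ofPred_eq, hybridIndex_smul w₁ w₂ x n h0]
    exact hu.2 hv

lemma avg_inner (y : ℕ → E) (n : ℕ) (u : E) :
    avg y n (fun z => inner ℝ u z) = inner ℝ u (sampleMean y n) := by
  simp [avg, sampleMean, inner_smul_right, inner_sum]

lemma avg_add {F : Type*} (y : ℕ → F) (n : ℕ) (f g : F → ℝ) :
    avg y n (fun z => f z + g z) = avg y n f + avg y n g := by
  simp [avg, Finset.sum_add_distrib, mul_add]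

lemma avg_sub {F : Type*} (y : ℕ → F) (n : ℕ) (f g : F → ℝ) :
    avg y n (fun z => f z - g z) = avg y n f - avg y n g := by
  simp [avg, Finset.sum_sub_distrib, mul_sub]

lemma avg_const_mul {F : Type*} (y : ℕ → F) (n : ℕ) (c : ℝ) (f : F → ℝ) :
    avg y n (fun z => c * f z) = c * avg y n f := by
  simp only [avg, ← Finset.mul_sum]
  ring

lemma avg_finset_sum {F ι : Type*} (y : ℕ → F) (n : ℕ) (s : Finset ι) (f : ι → F → ℝ) :
    avg y n (fun z => ∑ j ∈ s, f j z) = ∑ j ∈ s, avg y n (f j) := by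
  simp only [avg]
  rw [Finset.sum_comm, Finset.mul_sum]

lemma sampleMoment_eq_avg (y : ℕ → E) (n k : ℕ) (u : E) :
    sampleMoment y n k u = avg y n fun z => (inner ℝ u (z - sampleMean y n)) ^ k := rfl

/-- The `k`-th moment of the projection on `u` under `ν`. -/
def popMoment (ν : Measure E) (k : ℕ) (u : E) : ℝ := ∫ z, (inner ℝ u z) ^ k ∂ν

lemma MomentsConverge.tendsto_avg_mul {y : ℕ → E} {ν : Measure E}
    (hy : MomentsConverge y ν) {l : Filter ℕ} (hl : l ≤ atTop)
    {a b c d : ℕ → E × ℝ} {a₀ b₀ c₀ d₀ : E × ℝ} (ha : Tendsto a l (𝓝 a₀)) (hb : Tendsto b l (𝓝 b₀))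
    (hc : Tendsto c l (𝓝 c₀)) (hd : Tendsto d l (𝓝 d₀)) :
    Tendsto (fun n => avg y n fun z =>
      affine (a n) z * affine (b n) z * affine (c n) z * affine (d n) z) l
      (𝓝 (∫ z, affine a₀ z * affine b₀ z * affine c₀ z * affine d₀ z ∂ν)) := by
  have := hy l hl ![a, b, c, d] ![a₀, b₀, c₀, d₀] (fun j => by fin_cases j <;> assumption)
  simpa [Fin.prod_univ_four] using this

-- The constant functional (0, 1) pads products of fewer than four projections, so moments of every
-- order up to 4 follow from the four-factor statement.
@[simp] lemma affine_one (z : E) : affine ((0 : E), (1 : ℝ)) z = 1 := by simp [affine]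

@[simp] lemma affine_linear (u z : E) : affine (u, (0 : ℝ)) z = inner ℝ u z := by simp [affine]

lemma MomentsConverge.tendsto_inner_sampleMean {y : ℕ → E} {ν : Measure E}
    (hy : MomentsConverge y ν)
    (hmean : ∀ u : E, ∫ z, (inner ℝ u z : ℝ) ∂ν = 0) {l : Filter ℕ} (hl : l ≤ atTop)
    {u : ℕ → E} {u₀ : E} (hu : Tendsto u l (𝓝 u₀)) :
    Tendsto (fun n => inner ℝ (u n) (sampleMean y n)) l (𝓝 (0 : ℝ)) := by
  have h1 : Tendsto (fun _ : ℕ => ((0 : E), (1 : ℝ))) l (𝓝 (0, 1)) := tendsto_const_nhds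
  have := hy.tendsto_avg_mul hl (hu.prodMk_nhds (tendsto_const_nhds (x := (0 : ℝ)))) h1 h1 h1
  simp only [affine_one, affine_linear, mul_one, hmean, avg_inner] at this
  exact this

lemma affine_sub (a : E × ℝ) (z m : E) :
    affine a (z - m) = affine (a.1, a.2 - inner ℝ a.1 m) z := by
  simp [affine, inner_sub_right]
  ring

/-- Centering at the sample mean does not change the limits of the empirical moments. -/
lemma MomentsConverge.tendsto_avg_mul_centered {y : ℕ → E} {ν : Measure E}
    (hy : MomentsConverge y ν)
    (hmean : ∀ u : E, ∫ z, (inner ℝ u z : ℝ) ∂ν = 0) {l : Filter ℕ} (hl : l ≤ atTop)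
    {a b c d : ℕ → E × ℝ} {a₀ b₀ c₀ d₀ : E × ℝ} (ha : Tendsto a l (𝓝 a₀)) (hb : Tendsto b l (𝓝 b₀))
    (hc : Tendsto c l (𝓝 c₀)) (hd : Tendsto d l (𝓝 d₀)) :
    Tendsto (fun n => avg y n fun z =>
      affine (a n) (z - sampleMean y n) * affine (b n) (z - sampleMean y n) *
        affine (c n) (z - sampleMean y n) * affine (d n) (z - sampleMean y n)) l
      (𝓝 (∫ z, affine a₀ z * affine b₀ z * affine c₀ z * affine d₀ z ∂ν)) := by
  -- Centering only changes the constant term of each affine functional, by a quantity that tends to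
  -- 0.
  have key : ∀ {a : ℕ → E × ℝ} {a₀ : E × ℝ}, Tendsto a l (𝓝 a₀) →
      Tendsto (fun n => ((a n).1, (a n).2 - inner ℝ (a n).1 (sampleMean y n))) l (𝓝 a₀) := by
    intro a a₀ ha
    have h1 := (continuous_fst.tendsto a₀).comp ha
    have h2 := (continuous_snd.tendsto a₀).comp ha
    have := h1.prodMk_nhds (h2.sub (hy.tendsto_inner_sampleMean hmean hl h1))
    simpa using this
  simp only [affine_sub]
  exact hy.tendsto_avg_mul hl (key ha) (key hb) (key hc) (key hd)

lemma MomentsConverge.tendsto_sampleMoment {y : ℕ → E} {ν : Measure E}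
    (hy : MomentsConverge y ν)
    (hmean : ∀ u : E, ∫ z, (inner ℝ u z : ℝ) ∂ν = 0) {l : Filter ℕ} (hl : l ≤ atTop)
    {u : ℕ → E} {u₀ : E} (hu : Tendsto u l (𝓝 u₀)) {k : ℕ} (hk : k ≤ 4) :
    Tendsto (fun n => sampleMoment y n k (u n)) l (𝓝 (popMoment ν k u₀)) := by
  have h1 : Tendsto (fun _ : ℕ => ((0 : E), (1 : ℝ))) l (𝓝 (0, 1)) := tendsto_const_nhds
  have h2 := hu.prodMk_nhds (tendsto_const_nhds (x := (0 : ℝ)))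
  simp only [sampleMoment_eq_avg, popMoment]
  interval_cases k
  · simpa using hy.tendsto_avg_mul_centered hmean hl h1 h1 h1 h1
  · simpa using hy.tendsto_avg_mul_centered hmean hl h2 h1 h1 h1
  · simpa [pow_succ] using hy.tendsto_avg_mul_centered hmean hl h2 h2 h1 h1
  · simpa [pow_succ] using hy.tendsto_avg_mul_centered hmean hl h2 h2 h2 h1
  · simpa [pow_succ] using hy.tendsto_avg_mul_centered hmean hl h2 h2 h2 h2

lemma tendsto_indexOfMoments (w₁ w₂ : ℝ) {l : Filter ℕ} {a b c : ℕ → ℝ} {a₀ b₀ c₀ : ℝ}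
    (ha : Tendsto a l (𝓝 a₀)) (hb : Tendsto b l (𝓝 b₀)) (hc : Tendsto c l (𝓝 c₀)) (h0 : a₀ ≠ 0) :
    Tendsto (fun n => indexOfMoments w₁ w₂ (a n) (b n) (c n)) l
      (𝓝 (indexOfMoments w₁ w₂ a₀ b₀ c₀)) :=
  (((hb.pow 2).div (ha.pow 3) (pow_ne_zero _ h0)).const_mul w₁).add
    ((((hc.div (ha.pow 2) (pow_ne_zero _ h0)).sub_const 3).pow 2).const_mul w₂)

/-- The population version of the hybrid index. -/
def popIndex (w₁ w₂ : ℝ) (ν : Measure E) (u : E) : ℝ :=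
  indexOfMoments w₁ w₂ (popMoment ν 2 u) (popMoment ν 3 u) (popMoment ν 4 u)

lemma MomentsConverge.tendsto_hybridIndex {y : ℕ → E} {ν : Measure E}
    (hy : MomentsConverge y ν)
    (hmean : ∀ u : E, ∫ z, (inner ℝ u z : ℝ) ∂ν = 0) (w₁ w₂ : ℝ) {l : Filter ℕ} (hl : l ≤ atTop)
    {u : ℕ → E} {u₀ : E} (hu : Tendsto u l (𝓝 u₀)) (h0 : popMoment ν 2 u₀ ≠ 0) :
    Tendsto (fun n => hybridIndex w₁ w₂ y n (u n)) l (𝓝 (popIndex w₁ w₂ ν u₀)) := by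
  simp only [hybridIndex_eq, popIndex]
  exact tendsto_indexOfMoments w₁ w₂ (hy.tendsto_sampleMoment hmean hl hu (by norm_num))
    (hy.tendsto_sampleMoment hmean hl hu (by norm_num))
    (hy.tendsto_sampleMoment hmean hl hu (by norm_num)) h0

/-- Consistency of the maximizers, given that the population index has a unique maximizer in the
closed half-sphere `0 ≤ ⟪θ, ·⟫`. -/
theorem MomentsConverge.tendsto_maximizer {y : ℕ → E} {ν : Measure E}
    (hy : MomentsConverge y ν)
    (hmean : ∀ u : E, ∫ z, (inner ℝ u z : ℝ) ∂ν = 0) {w₁ w₂ : ℝ} {θ u₀ : E}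
    (hpos : ∀ u : E, u ≠ 0 → popMoment ν 2 u ≠ 0) (hu₀ : ‖u₀‖ = 1)
    (huniq : ∀ v : E, ‖v‖ = 1 → 0 ≤ (inner ℝ θ v : ℝ) →
      popIndex w₁ w₂ ν u₀ ≤ popIndex w₁ w₂ ν v → v = u₀)
    {u : ℕ → E} (hu : ∀ᶠ n in atTop, IsSphereMaximizer (hybridIndex w₁ w₂ y n) (u n))
    (hθ : ∀ n, 0 ≤ (inner ℝ θ (u n) : ℝ)) : Tendsto u atTop (𝓝 u₀) := by
  refine (isCompact_sphere (0 : E) 1).tendsto_nhds_of_unique_mapClusterPt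
    (hu.mono fun n hn => hn.1) fun v hv hcl => ?_
  have hne : ∀ v : E, ‖v‖ = 1 → v ≠ 0 := fun v hv h => by simp [h] at hv
  have hv1 : ‖v‖ = 1 := by simpa using hv
  -- Along this filter u tends to the cluster point v. It plays the role of a subsequence, which is
  -- why the convergence lemmas accept any l ≤ atTop.
  set l := atTop ⊓ comap u (𝓝 v) with hl
  have hlb : l.NeBot := by
    have : (map u atTop ⊓ 𝓝 v).NeBot := by rw [inf_comm]; exact hcl
    rw [← Filter.push_pull] at this
    exact this.of_map
  have hle : l ≤ atTop := inf_le_left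
  have hut : Tendsto u l (𝓝 v) := tendsto_comap.mono_left inf_le_right
  have h1 := hy.tendsto_hybridIndex hmean w₁ w₂ hle hut (hpos v (hne v hv1))
  have h2 := hy.tendsto_hybridIndex hmean w₁ w₂ hle (tendsto_const_nhds (x := u₀))
    (hpos u₀ (hne u₀ hu₀))
  refine huniq v hv1 ?_ ?_
  · exact ge_of_tendsto (((innerSL ℝ θ).continuous.tendsto v).comp hut)
      (Eventually.of_forall fun n => by simpa using hθ n)
  · refine le_of_tendsto_of_tendsto h2 h1 ((hu.filter_mono hle).mono fun n hn => ?_)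
    exact hn.2 (by simpa using hu₀)

end Consistency

open Asymptotics

/-! ### The first order condition -/

section FirstOrder

variable {p : ℕ}

local notation "E" => EuclideanSpace ℝ (Fin p)

/-- The partial derivative of the empirical moment of order `k + 1`, divided by `k + 1`. -/
def sampleGrad (y : ℕ → E) (n k : ℕ) (v b : E) : ℝ :=
  avg y n fun z => (inner ℝ v (z - sampleMean y n)) ^ k * inner ℝ b (z - sampleMean y n)

lemma hasDerivAt_sampleMoment (y : ℕ → E) (n k : ℕ) (v b : E) :
    HasDerivAt (fun ε : ℝ => sampleMoment y n (k + 1) (v + ε • b))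
      ((k + 1) * sampleGrad y n k v b) 0 := by
  unfold sampleMoment sampleGrad avg
  have h : ∀ i ∈ Finset.range n, HasDerivAt
      (fun ε : ℝ => (inner ℝ (v + ε • b) (y i - sampleMean y n)) ^ (k + 1))
      ((k + 1) * ((inner ℝ v (y i - sampleMean y n)) ^ k *
        inner ℝ b (y i - sampleMean y n))) (0 : ℝ) := by
    intro i _
    have h1 : HasDerivAt (fun ε : ℝ => (inner ℝ (v + ε • b) (y i - sampleMean y n) : ℝ))
        (inner ℝ b (y i - sampleMean y n)) 0 := by
      have := ((hasDerivAt_id (0 : ℝ)).mul_const (inner ℝ b (y i - sampleMean y n))).const_add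
        (inner ℝ v (y i - sampleMean y n))
      simpa [inner_add_left, inner_smul_left] using this
    refine (h1.pow (k + 1)).congr_deriv ?_
    simp
    ring
  refine ((HasDerivAt.fun_sum h).const_mul (n : ℝ)⁻¹).congr_deriv ?_
  rw [← Finset.mul_sum]
  ring

lemma hasDerivAt_indexOfMoments (w₁ w₂ : ℝ) {f g k : ℝ → ℝ} {f' g' k' : ℝ}
    (hf : HasDerivAt f f' 0) (hg : HasDerivAt g g' 0) (hk : HasDerivAt k k' 0) (h0 : f 0 ≠ 0) :
    HasDerivAt (fun ε => indexOfMoments w₁ w₂ (f ε) (g ε) (k ε))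
      (w₁ * (2 * g 0 * g' / f 0 ^ 3 - 3 * g 0 ^ 2 * f' / f 0 ^ 4) +
        2 * w₂ * (k 0 / f 0 ^ 2 - 3) * (k' / f 0 ^ 2 - 2 * k 0 * f' / f 0 ^ 3)) 0 := by
  have h1 := ((hg.pow 2).div (hf.pow 3) (pow_ne_zero 3 h0)).const_mul w₁
  have h2 := (((hk.div (hf.pow 2) (pow_ne_zero 2 h0)).sub_const 3).pow 2).const_mul w₂
  refine (h1.add h2).congr_deriv ?_
  simp only [Pi.div_apply, Pi.pow_apply, Nat.cast_ofNat, show 2 - 1 = 1 from rfl,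
    show 3 - 1 = 2 from rfl, pow_one]
  field_simp

/-- The first order condition for a maximizer of the hybrid index. -/
lemma sampleGrad_eq_zero_of_maximizer {w₁ w₂ : ℝ} {y : ℕ → E} {n : ℕ} {v : E}
    (hv : v ≠ 0) (hmax : ∀ v', v' ≠ 0 → hybridIndex w₁ w₂ y n v' ≤ hybridIndex w₁ w₂ y n v)
    (h2 : sampleMoment y n 2 v ≠ 0) (b : E) :
    6 * w₁ * (sampleMoment y n 3 v / sampleMoment y n 2 v ^ 3) * sampleGrad y n 2 v b +
      8 * w₂ * ((sampleMoment y n 4 v / sampleMoment y n 2 v ^ 2 - 3) /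
        sampleMoment y n 2 v ^ 2) * sampleGrad y n 3 v b -
      (6 * w₁ * (sampleMoment y n 3 v / sampleMoment y n 2 v ^ 3) *
          (sampleMoment y n 3 v / sampleMoment y n 2 v) +
        8 * w₂ * ((sampleMoment y n 4 v / sampleMoment y n 2 v ^ 2 - 3) /
          sampleMoment y n 2 v ^ 2) * (sampleMoment y n 4 v / sampleMoment y n 2 v)) *
        sampleGrad y n 1 v b = 0 := by
  have hd := hasDerivAt_indexOfMoments w₁ w₂ (hasDerivAt_sampleMoment y n 1 v b)
    (hasDerivAt_sampleMoment y n 2 v b) (hasDerivAt_sampleMoment y n 3 v b) (by simpa using h2)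
  -- The maximum is over all nonzero vectors, so b need not be tangent to the sphere.
  have hloc : IsLocalMax (fun ε : ℝ => indexOfMoments w₁ w₂ (sampleMoment y n (1 + 1) (v + ε • b))
      (sampleMoment y n (2 + 1) (v + ε • b)) (sampleMoment y n (3 + 1) (v + ε • b))) 0 := by
    have hc : Tendsto (fun ε : ℝ => v + ε • b) (𝓝 0) (𝓝 (v + (0 : ℝ) • b)) :=
      Continuous.tendsto (by fun_prop) 0
    rw [zero_smul, add_zero] at hc
    filter_upwards [hc.eventually_ne hv] with ε hε
    have := hmax _ hε
    rw [hybridIndex_eq, hybridIndex_eq] at this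
    simpa using this
  have hz := hloc.hasDerivAt_eq_zero hd
  simp only [zero_smul, add_zero] at hz
  norm_num at hz
  rw [← hz]
  field_simp
  ring

end FirstOrder

/-! ### Little-o calculus for empirical linear functionals -/

section LocalExpansion

variable {p : ℕ}

local notation "E" => EuclideanSpace ℝ (Fin p)

lemma inner_eq_sum_coord (u z : E) :
    (inner ℝ u z : ℝ) = ∑ q, u q * inner ℝ (EuclideanSpace.single q (1 : ℝ)) z := by
  simp [PiLp.inner_apply, mul_comm]

lemma abs_coord_le_norm (u : E) (q : Fin p) : |u q| ≤ ‖u‖ := by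
  simpa using PiLp.norm_apply_le u q

lemma isLittleO_of_coord {R : ℕ → E} {g : ℕ → ℝ} (h : ∀ q, (fun n => R n q) =o[atTop] g) :
    R =o[atTop] g := by
  have e : R = fun n => ∑ q, R n q • EuclideanSpace.basisFun (Fin p) ℝ q := by
    ext1 n
    simpa using ((EuclideanSpace.basisFun (Fin p) ℝ).sum_repr (R n)).symm
  rw [e]
  refine IsLittleO.fun_sum fun q _ => IsBigO.trans_isLittleO ?_ (h q)
  exact IsBigO.of_bound 1 (Eventually.of_forall fun n => by simp [norm_smul])

/-- In finite dimension, pointwise convergence of linear functionals is convergence in norm, so it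
may be evaluated at a moving d n with an error o(‖d n‖). -/
lemma isLittleO_sub_of_tendsto_linear {f : ℕ → E → ℝ} {f₀ : E → ℝ}
    (hf : ∀ n u, f n u = ∑ q, u q * f n (EuclideanSpace.single q 1))
    (hf₀ : ∀ u, f₀ u = ∑ q, u q * f₀ (EuclideanSpace.single q 1))
    (h : ∀ u, Tendsto (fun n => f n u) atTop (𝓝 (f₀ u))) (d : ℕ → E) :
    (fun n => f n (d n) - f₀ (d n)) =o[atTop] d := by
  have e : (fun n => f n (d n) - f₀ (d n)) = fun n => ∑ q, d n q *
      (f n (EuclideanSpace.single q 1) - f₀ (EuclideanSpace.single q 1)) := by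
    ext n
    rw [hf n, hf₀, ← Finset.sum_sub_distrib]
    exact Finset.sum_congr rfl fun q _ => by ring
  rw [e]
  refine IsLittleO.fun_sum fun q _ => ?_
  have h1 : (fun n => d n q) =O[atTop] d :=
    IsBigO.of_bound 1 (Eventually.of_forall fun n => by simpa using abs_coord_le_norm (d n) q)
  have h2 : (fun n => f n (EuclideanSpace.single q 1) - f₀ (EuclideanSpace.single q 1))
      =o[atTop] fun _ => (1 : ℝ) :=
    (isLittleO_one_iff ℝ).2 (tendsto_sub_nhds_zero_iff.2 (h _))
  have h3 := h1.norm_right.mul_isLittleO h2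
  simp only [mul_one] at h3
  exact h3.of_norm_right

lemma hasAllMoments_affine {ν : Measure E} [IsProbabilityMeasure ν]
    (hν : ∀ u : E, HasAllMoments (fun z => inner ℝ u z) ν) (a : E × ℝ) :
    HasAllMoments (affine a) ν :=
  (HasAllMoments.const a.2).add (hν a.1)

/-- The average is linear in d n, so consistency of the moments already gives an error relative to
‖d n‖. No rate for the empirical process is needed. -/
lemma MomentsConverge.isLittleO_avg_sub {y : ℕ → E} {ν : Measure E} [IsProbabilityMeasure ν]
    (hy : MomentsConverge y ν) (hν : ∀ u : E, HasAllMoments (fun z => inner ℝ u z) ν)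
    (hmean : ∀ u : E, ∫ z, (inner ℝ u z : ℝ) ∂ν = 0) (b : E) {f g : ℕ → E × ℝ} {f₀ g₀ : E × ℝ}
    (hf : Tendsto f atTop (𝓝 f₀)) (hg : Tendsto g atTop (𝓝 g₀)) (d : ℕ → E) :
    (fun n => avg y n (fun z => inner ℝ (d n) (z - sampleMean y n) *
        (inner ℝ b (z - sampleMean y n) * affine (f n) (z - sampleMean y n) *
          affine (g n) (z - sampleMean y n))) -
      ∫ z, inner ℝ (d n) z * (inner ℝ b z * affine f₀ z * affine g₀ z) ∂ν) =o[atTop] d := by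
  refine isLittleO_sub_of_tendsto_linear
    (f := fun n u => avg y n (fun z => inner ℝ u (z - sampleMean y n) *
        (inner ℝ b (z - sampleMean y n) * affine (f n) (z - sampleMean y n) *
          affine (g n) (z - sampleMean y n))))
    (f₀ := fun u => ∫ z, inner ℝ u z * (inner ℝ b z * affine f₀ z * affine g₀ z) ∂ν) ?_ ?_ ?_ d
  · intro n u
    simp_rw [← avg_const_mul, ← avg_finset_sum]
    congr 1
    ext z
    rw [inner_eq_sum_coord u, Finset.sum_mul]
    exact Finset.sum_congr rfl fun q _ => by ring
  · intro u
    simp_rw [← integral_const_mul]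
    rw [← integral_finsetSum]
    · congr 1
      ext z
      rw [inner_eq_sum_coord u, Finset.sum_mul]
      exact Finset.sum_congr rfl fun q _ => by ring
    · exact fun q _ => (((hν _).mul (((hν b).mul (hasAllMoments_affine hν f₀)).mul
        (hasAllMoments_affine hν g₀))).const_mul _).integrable
  · intro u
    have h := hy.tendsto_avg_mul_centered hmean le_rfl
      (tendsto_const_nhds (x := (u, (0 : ℝ)))) (tendsto_const_nhds (x := (b, (0 : ℝ)))) hf hg
    simpa [mul_assoc] using h

/-- Split cF - c₀f = (c - c₀)f + c(F - f). It serves to replace random coefficients by their limits.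
-/
lemma isLittleO_mul_sub_mul {c f F : ℕ → ℝ} {c₀ : ℝ} {σ : ℕ → ℝ} (hc : Tendsto c atTop (𝓝 c₀))
    (hf : f =O[atTop] σ) (hF : (fun n => F n - f n) =o[atTop] σ) :
    (fun n => c n * F n - c₀ * f n) =o[atTop] σ := by
  have h1 : (fun n => c n - c₀) =o[atTop] fun _ => (1 : ℝ) :=
    (isLittleO_one_iff ℝ).2 (tendsto_sub_nhds_zero_iff.2 hc)
  have h2 : c =O[atTop] fun _ => (1 : ℝ) := hc.isBigO_one ℝ
  have h3 := (h1.mul_isBigO hf).add (h2.mul_isLittleO hF)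
  simp only [one_mul] at h3
  refine h3.congr_left fun n => ?_
  ring

lemma isLittleO_tendsto_zero_mul {c f σ : ℕ → ℝ} (hc : Tendsto c atTop (𝓝 0))
    (hf : f =O[atTop] σ) : (fun n => c n * f n) =o[atTop] σ := by
  simpa using ((isLittleO_one_iff ℝ).2 hc).mul_isBigO hf

end LocalExpansion

/-! ### Expansion of the empirical gradient at θ -/

section GradientExpansion

variable {p : ℕ}

local notation "E" => EuclideanSpace ℝ (Fin p)

/-- The empirical average of `⟪θ, z⟫ ^ j * ⟪b, z⟫`. -/
def crossAvg (y : ℕ → E) (θ : E) (n j : ℕ) (b : E) : ℝ :=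
  avg y n fun z => (inner ℝ θ z) ^ j * inner ℝ b z

lemma sampleGrad_eq (y : ℕ → E) (n k : ℕ) (θ b : E) :
    sampleGrad y n k θ b =
      avg y n (fun z => (inner ℝ θ z - inner ℝ θ (sampleMean y n)) ^ k * inner ℝ b z) -
        sampleMoment y n k θ * crossAvg y θ n 0 b := by
  have h0 : crossAvg y θ n 0 b = inner ℝ b (sampleMean y n) := by
    simp [crossAvg, avg_inner]
  rw [h0, mul_comm, sampleMoment_eq_avg, ← avg_const_mul, ← avg_sub, sampleGrad]
  congr 1
  ext z
  simp only [inner_sub_right]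
  ring

lemma sampleGrad_one (y : ℕ → E) (n : ℕ) (θ b : E) :
    sampleGrad y n 1 θ b = crossAvg y θ n 1 b - inner ℝ θ (sampleMean y n) * crossAvg y θ n 0 b -
      sampleMoment y n 1 θ * crossAvg y θ n 0 b := by
  rw [sampleGrad_eq]
  congr 1
  simp only [crossAvg, ← avg_const_mul, ← avg_sub]
  congr 1
  ext z
  ring

lemma sampleGrad_two (y : ℕ → E) (n : ℕ) (θ b : E) :
    sampleGrad y n 2 θ b = crossAvg y θ n 2 b -
      2 * inner ℝ θ (sampleMean y n) * crossAvg y θ n 1 b +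
      (inner ℝ θ (sampleMean y n)) ^ 2 * crossAvg y θ n 0 b -
      sampleMoment y n 2 θ * crossAvg y θ n 0 b := by
  rw [sampleGrad_eq]
  congr 1
  simp only [crossAvg, ← avg_const_mul, ← avg_sub, ← avg_add]
  congr 1
  ext z
  ring

lemma sampleGrad_three (y : ℕ → E) (n : ℕ) (θ b : E) :
    sampleGrad y n 3 θ b = crossAvg y θ n 3 b -
      3 * inner ℝ θ (sampleMean y n) * crossAvg y θ n 2 b +
      3 * (inner ℝ θ (sampleMean y n)) ^ 2 * crossAvg y θ n 1 b -
      (inner ℝ θ (sampleMean y n)) ^ 3 * crossAvg y θ n 0 b -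
      sampleMoment y n 3 θ * crossAvg y θ n 0 b := by
  rw [sampleGrad_eq]
  congr 1
  simp only [crossAvg, ← avg_const_mul, ← avg_sub, ← avg_add]
  congr 1
  ext z
  ring

/-- The second order structure of a law `ν` at a direction `θ` for which `⟪θ, ·⟫` is independent
of the projections orthogonal to `h`, the operator `B` being a generalized inverse of the
covariance of the latter. -/
structure IsProjectionModel (ν : Measure E) (θ h : E) (B : E →L[ℝ] E) : Prop where
  isProb : IsProbabilityMeasure ν
  moments : ∀ u : E, HasAllMoments (fun z => inner ℝ u z) ν
  mean : ∀ u : E, ∫ z, (inner ℝ u z : ℝ) ∂ν = 0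
  inner_pos : 0 < (inner ℝ θ h : ℝ)
  symm : ∀ u v : E, (inner ℝ (B u) v : ℝ) = inner ℝ u (B v)
  cross_zero : ∀ d e : E, (inner ℝ d h : ℝ) = 0 →
    ∫ z, inner ℝ d z * inner ℝ (B e) z ∂ν = (inner ℝ d e : ℝ)
  cross_one : ∀ d e : E, (inner ℝ d h : ℝ) = 0 →
    ∫ z, inner ℝ d z * (inner ℝ (B e) z * inner ℝ θ z) ∂ν = (0 : ℝ)
  cross_two : ∀ d e : E, (inner ℝ d h : ℝ) = 0 →
    ∫ z, inner ℝ d z * (inner ℝ (B e) z * inner ℝ θ z * inner ℝ θ z) ∂ν =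
      popMoment ν 2 θ * inner ℝ d e

/-- Centering at the sample mean creates products of a cross average, which is O(σ), with the sample
mean or a sample moment. The former factor vanishes in the limit; the latter leaves only its
population value times the average of ⟪b, ·⟫, which is zero at order 1. -/
lemma isLittleO_sampleGrad_sub {y : ℕ → E} {ν : Measure E}
    (hy : MomentsConverge y ν) (hmean : ∀ u : E, ∫ z, (inner ℝ u z : ℝ) ∂ν = 0) (θ b : E)
    {σ : ℕ → ℝ} (hσ : ∀ j ≤ 3, (fun n => crossAvg y θ n j b) =O[atTop] σ) :
    ((fun n => sampleGrad y n 1 θ b - crossAvg y θ n 1 b) =o[atTop] σ) ∧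
    ((fun n => sampleGrad y n 2 θ b -
      (crossAvg y θ n 2 b - popMoment ν 2 θ * crossAvg y θ n 0 b)) =o[atTop] σ) ∧
    ((fun n => sampleGrad y n 3 θ b -
      (crossAvg y θ n 3 b - popMoment ν 3 θ * crossAvg y θ n 0 b)) =o[atTop] σ) := by
  have hs : Tendsto (fun n => inner ℝ θ (sampleMean y n)) atTop (𝓝 (0 : ℝ)) :=
    hy.tendsto_inner_sampleMean hmean le_rfl tendsto_const_nhds
  have hM : ∀ k ≤ 4, Tendsto (fun n => popMoment ν k θ - sampleMoment y n k θ) atTop (𝓝 0) := by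
    intro k hk
    have := (hy.tendsto_sampleMoment hmean le_rfl (tendsto_const_nhds (x := θ)) hk).const_sub
      (popMoment ν k θ)
    simpa using this
  have hM1 : popMoment ν 1 θ = 0 := by simpa [popMoment] using hmean θ
  have h0 := hσ 0 (by norm_num)
  have h1 := hσ 1 (by norm_num)
  have h2 := hσ 2 (by norm_num)
  refine ⟨?_, ?_, ?_⟩
  · have hc : Tendsto (fun n => (popMoment ν 1 θ - sampleMoment y n 1 θ) -
        inner ℝ θ (sampleMean y n)) atTop (𝓝 0) := by
      simpa using (hM 1 (by norm_num)).sub hs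
    refine (isLittleO_tendsto_zero_mul hc h0).congr_left fun n => ?_
    rw [sampleGrad_one, hM1]
    ring
  · have hc : Tendsto (fun n => (popMoment ν 2 θ - sampleMoment y n 2 θ) +
        (inner ℝ θ (sampleMean y n)) ^ 2) atTop (𝓝 0) := by
      simpa using (hM 2 (by norm_num)).add (hs.pow 2)
    have hc1 : Tendsto (fun n => -2 * inner ℝ θ (sampleMean y n)) atTop (𝓝 (0 : ℝ)) := by
      simpa using hs.const_mul (-2)
    refine ((isLittleO_tendsto_zero_mul hc h0).add
      (isLittleO_tendsto_zero_mul hc1 h1)).congr_left fun n => ?_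
    rw [sampleGrad_two]
    ring
  · have hc : Tendsto (fun n => (popMoment ν 3 θ - sampleMoment y n 3 θ) -
        (inner ℝ θ (sampleMean y n)) ^ 3) atTop (𝓝 0) := by
      simpa using (hM 3 (by norm_num)).sub (hs.pow 3)
    have hc1 : Tendsto (fun n => 3 * (inner ℝ θ (sampleMean y n)) ^ 2) atTop (𝓝 (0 : ℝ)) := by
      simpa using (hs.pow 2).const_mul 3
    have hc2 : Tendsto (fun n => -3 * inner ℝ θ (sampleMean y n)) atTop (𝓝 (0 : ℝ)) := by
      simpa using hs.const_mul (-3)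
    refine (((isLittleO_tendsto_zero_mul hc h0).add (isLittleO_tendsto_zero_mul hc1 h1)).add
      (isLittleO_tendsto_zero_mul hc2 h2)).congr_left fun n => ?_
    rw [sampleGrad_three]
    ring

/-- The difference of k-th powers is ⟪d, z⟫ times k products of order k - 1 in ⟪θ, z⟫ and ⟪θ + d,
z⟫, all with the same limit. By independence that limit is a moment of order k - 1 times ⟪d, e⟫: it
is 0 for k = 2, and it occurs three times for k = 3. -/
lemma IsProjectionModel.isLittleO_sampleGrad_add {y : ℕ → E} {ν : Measure E} {θ h : E}
    {B : E →L[ℝ] E} (H : IsProjectionModel ν θ h B) (hy : MomentsConverge y ν) {d : ℕ → E}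
    (hd : Tendsto d atTop (𝓝 0)) (hdh : ∀ n, (inner ℝ (d n) h : ℝ) = 0) (e : E) :
    ((fun n => sampleGrad y n 1 (θ + d n) (B e) - sampleGrad y n 1 θ (B e) - inner ℝ (d n) e)
      =o[atTop] d) ∧
    ((fun n => sampleGrad y n 2 (θ + d n) (B e) - sampleGrad y n 2 θ (B e)) =o[atTop] d) ∧
    ((fun n => sampleGrad y n 3 (θ + d n) (B e) - sampleGrad y n 3 θ (B e) -
      3 * popMoment ν 2 θ * inner ℝ (d n) e) =o[atTop] d) := by
  have := H.isProb
  have c1 : Tendsto (fun _ : ℕ => ((0 : E), (1 : ℝ))) atTop (𝓝 (0, 1)) := tendsto_const_nhds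
  have cθ : Tendsto (fun _ : ℕ => (θ, (0 : ℝ))) atTop (𝓝 (θ, 0)) := tendsto_const_nhds
  have cv : Tendsto (fun n : ℕ => (θ + d n, (0 : ℝ))) atTop (𝓝 (θ, 0)) := by
    simpa using (hd.const_add θ).prodMk_nhds (tendsto_const_nhds (x := (0 : ℝ)))
  have A : ∀ {f g : ℕ → E × ℝ} {f₀ g₀ : E × ℝ}, Tendsto f atTop (𝓝 f₀) → Tendsto g atTop (𝓝 g₀) →
      _ := fun {f g f₀ g₀} hf hg =>
    hy.isLittleO_avg_sub H.moments H.mean (B e) (f := f) (g := g) (f₀ := f₀) (g₀ := g₀) hf hg d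
  have e0 : ∀ n, ∫ z, inner ℝ (d n) z * inner ℝ (B e) z ∂ν = (inner ℝ (d n) e : ℝ) :=
    fun n => H.cross_zero _ _ (hdh n)
  have e1 : ∀ n, ∫ z, inner ℝ (d n) z * (inner ℝ (B e) z * inner ℝ θ z) ∂ν = (0 : ℝ) :=
    fun n => H.cross_one _ _ (hdh n)
  have e2 : ∀ n, ∫ z, inner ℝ (d n) z * (inner ℝ (B e) z * inner ℝ θ z * inner ℝ θ z) ∂ν =
    popMoment ν 2 θ * inner ℝ (d n) e := fun n => H.cross_two _ _ (hdh n)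
  refine ⟨?_, ?_, ?_⟩
  · have a := A c1 c1
    simp only [affine_one, mul_one, e0] at a
    refine a.congr_left fun n => ?_
    rw [sampleGrad, sampleGrad, ← avg_sub]
    congr 2
    ext z
    simp only [inner_add_left]
    ring
  · have a := (A cθ c1).add (A cv c1)
    simp only [affine_one, affine_linear, mul_one, e1, sub_zero] at a
    refine a.congr_left fun n => ?_
    rw [sampleGrad, sampleGrad, ← avg_sub, ← avg_add]
    congr 1
    ext z
    simp only [inner_add_left]
    ring
  · have a := ((A cθ cθ).add (A cv cθ)).add (A cv cv)
    simp only [affine_linear, e2] at a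
    refine a.congr_left fun n => ?_
    have : sampleGrad y n 3 (θ + d n) (B e) - sampleGrad y n 3 θ (B e) =
        (avg y n fun z => inner ℝ (d n) (z - sampleMean y n) *
          (inner ℝ (B e) (z - sampleMean y n) * inner ℝ θ (z - sampleMean y n) *
            inner ℝ θ (z - sampleMean y n))) +
        (avg y n fun z => inner ℝ (d n) (z - sampleMean y n) *
          (inner ℝ (B e) (z - sampleMean y n) * inner ℝ (θ + d n) (z - sampleMean y n) *
            inner ℝ θ (z - sampleMean y n))) +
        avg y n fun z => inner ℝ (d n) (z - sampleMean y n) *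
          (inner ℝ (B e) (z - sampleMean y n) * inner ℝ (θ + d n) (z - sampleMean y n) *
            inner ℝ (θ + d n) (z - sampleMean y n)) := by
      rw [sampleGrad, sampleGrad, ← avg_sub, ← avg_add, ← avg_add]
      congr 1
      ext z
      simp only [inner_add_left]
      ring
    rw [this]
    ring

/-- The limiting weight of the squared projections in the estimating equation. -/
def coefSkew (w₁ : ℝ) (ν : Measure E) (θ : E) : ℝ :=
  6 * w₁ * (popMoment ν 3 θ / popMoment ν 2 θ ^ 3)

/-- The limiting weight of the cubed projections in the estimating equation. -/
def coefKurt (w₂ : ℝ) (ν : Measure E) (θ : E) : ℝ :=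
  8 * w₂ * ((popMoment ν 4 θ / popMoment ν 2 θ ^ 2 - 3) / popMoment ν 2 θ ^ 2)

/-- The limiting weight of the projections themselves in the estimating equation. -/
def coefLin (w₁ w₂ : ℝ) (ν : Measure E) (θ : E) : ℝ :=
  coefSkew w₁ ν θ * (popMoment ν 3 θ / popMoment ν 2 θ) +
    coefKurt w₂ ν θ * (popMoment ν 4 θ / popMoment ν 2 θ)

/-- The score function of the estimating equation. -/
def score (w₁ w₂ : ℝ) (ν : Measure E) (θ : E) (s : ℝ) : ℝ :=
  coefSkew w₁ ν θ * (s ^ 2 - popMoment ν 2 θ) + coefKurt w₂ ν θ * (s ^ 3 - popMoment ν 3 θ) -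
    coefLin w₁ w₂ ν θ * s

/-- The curvature of the population index at its maximizer. -/
def curvature (w₁ w₂ : ℝ) (ν : Measure E) (θ : E) : ℝ :=
  3 * coefKurt w₂ ν θ * popMoment ν 2 θ - coefLin w₁ w₂ ν θ

/-- The empirical average of the scores. -/
def scoreAvg (w₁ w₂ : ℝ) (ν : Measure E) (θ : E) (B : E →L[ℝ] E) (y : ℕ → E) (n : ℕ) : E :=
  (n : ℝ)⁻¹ • ∑ i ∈ Finset.range n, score w₁ w₂ ν θ (inner ℝ θ (y i)) • B (y i)

/-- The total size of the empirical averages which govern the fluctuations. -/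
def fluctuation (θ : E) (B : E →L[ℝ] E) (y : ℕ → E) (n : ℕ) : ℝ :=
  ∑ jq : Fin 4 × Fin p, |crossAvg y θ n jq.1 (B (EuclideanSpace.single jq.2 1))|

lemma isBigO_crossAvg (θ : E) (B : E →L[ℝ] E) (y : ℕ → E) (q : Fin p) {j : ℕ} (hj : j ≤ 3) :
    (fun n => crossAvg y θ n j (B (EuclideanSpace.single q 1))) =O[atTop] fluctuation θ B y := by
  refine IsBigO.of_bound 1 (Eventually.of_forall fun n => ?_)
  have h := Finset.single_le_sum (f := fun jq : Fin 4 × Fin p =>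
    |crossAvg y θ n jq.1 (B (EuclideanSpace.single jq.2 1))|) (fun _ _ => abs_nonneg _)
    (Finset.mem_univ (⟨j, by omega⟩, q))
  rw [one_mul, Real.norm_eq_abs]
  exact h.trans (le_abs_self _)

lemma IsProjectionModel.scoreAvg_apply {ν : Measure E} {θ h : E} {B : E →L[ℝ] E}
    (H : IsProjectionModel ν θ h B) (w₁ w₂ : ℝ) (y : ℕ → E) (n : ℕ) (q : Fin p) :
    scoreAvg w₁ w₂ ν θ B y n q =
      coefSkew w₁ ν θ * (crossAvg y θ n 2 (B (EuclideanSpace.single q 1)) -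
        popMoment ν 2 θ * crossAvg y θ n 0 (B (EuclideanSpace.single q 1))) +
      coefKurt w₂ ν θ * (crossAvg y θ n 3 (B (EuclideanSpace.single q 1)) -
        popMoment ν 3 θ * crossAvg y θ n 0 (B (EuclideanSpace.single q 1))) -
      coefLin w₁ w₂ ν θ * crossAvg y θ n 1 (B (EuclideanSpace.single q 1)) := by
  have h1 : scoreAvg w₁ w₂ ν θ B y n q = avg y n fun z =>
      score w₁ w₂ ν θ (inner ℝ θ z) * inner ℝ (B (EuclideanSpace.single q 1)) z := by
    simp [scoreAvg, avg, H.symm, EuclideanSpace.inner_single_left]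
  rw [h1]
  simp only [crossAvg]
  simp only [← avg_const_mul, ← avg_sub, ← avg_add]
  congr 1
  ext z
  simp only [score]
  ring

end GradientExpansion

/-! ### Linear expansion of the maximizer -/

section MaximizerExpansion

variable {p : ℕ}

local notation "E" => EuclideanSpace ℝ (Fin p)

/-- This is the first order condition in the directions B e_q, with coefficients replaced by their
limits. The terms linear in d combine into `curvature` times the coordinate d_q. -/
lemma IsProjectionModel.isLittleO_residual {y : ℕ → E} {ν : Measure E} {θ h : E}
    {B : E →L[ℝ] E} (H : IsProjectionModel ν θ h B) (hy : MomentsConverge y ν) {d : ℕ → E}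
    (hd : Tendsto d atTop (𝓝 0)) (hdh : ∀ n, (inner ℝ (d n) h : ℝ) = 0) {w₁ w₂ : ℝ}
    (hM : popMoment ν 2 θ ≠ 0)
    (hmax : ∀ᶠ n in atTop, ∀ v, v ≠ 0 →
      hybridIndex w₁ w₂ y n v ≤ hybridIndex w₁ w₂ y n (θ + d n)) :
    (fun n => scoreAvg w₁ w₂ ν θ B y n + curvature w₁ w₂ ν θ • d n) =o[atTop]
      fun n => fluctuation θ B y n + ‖d n‖ := by
  set σ : ℕ → ℝ := fun n => fluctuation θ B y n + ‖d n‖ with hσ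
  have ht0 : ∀ n, 0 ≤ fluctuation θ B y n := fun n => Finset.sum_nonneg fun _ _ => abs_nonneg _
  have htσ : fluctuation θ B y =O[atTop] σ := IsBigO.of_bound 1 (Eventually.of_forall fun n => by
    rw [Real.norm_of_nonneg (ht0 n), Real.norm_of_nonneg (add_nonneg (ht0 n) (norm_nonneg _))]
    simp)
  have hdσ : d =O[atTop] σ := IsBigO.of_bound 1 (Eventually.of_forall fun n => by
    rw [Real.norm_of_nonneg (add_nonneg (ht0 n) (norm_nonneg _))]
    simp [ht0 n])
  have hv : Tendsto (fun n => θ + d n) atTop (𝓝 θ) := by simpa using hd.const_add θ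
  have hθ : θ ≠ 0 := by
    rintro rfl
    simp [popMoment] at hM
  have hm : ∀ k ≤ 4, Tendsto (fun n => sampleMoment y n k (θ + d n)) atTop
      (𝓝 (popMoment ν k θ)) := fun k hk => hy.tendsto_sampleMoment H.mean le_rfl hv hk
  have hm2 := hm 2 (by norm_num)
  have hm3 := hm 3 (by norm_num)
  have hm4 := hm 4 (by norm_num)
  have ha : Tendsto (fun n => 6 * w₁ *
      (sampleMoment y n 3 (θ + d n) / sampleMoment y n 2 (θ + d n) ^ 3)) atTop
      (𝓝 (coefSkew w₁ ν θ)) :=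
    (hm3.div (hm2.pow 3) (pow_ne_zero _ hM)).const_mul _
  have hb : Tendsto (fun n => 8 * w₂ * ((sampleMoment y n 4 (θ + d n) /
      sampleMoment y n 2 (θ + d n) ^ 2 - 3) / sampleMoment y n 2 (θ + d n) ^ 2)) atTop
      (𝓝 (coefKurt w₂ ν θ)) :=
    ((((hm4.div (hm2.pow 2) (pow_ne_zero _ hM)).sub_const 3).div (hm2.pow 2)
      (pow_ne_zero _ hM))).const_mul _
  have hc := (ha.mul (hm3.div hm2 hM)).add (hb.mul (hm4.div hm2 hM))
  refine isLittleO_of_coord fun q => ?_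
  set e : E := EuclideanSpace.single q 1 with he
  have hcr : ∀ j ≤ 3, (fun n => crossAvg y θ n j (B e)) =O[atTop] σ :=
    fun j hj => (isBigO_crossAvg θ B y q hj).trans htσ
  have hde : (fun n => (inner ℝ (d n) e : ℝ)) =O[atTop] σ := by
    refine IsBigO.trans (IsBigO.of_bound 1 (Eventually.of_forall fun n => ?_)) hdσ
    rw [one_mul]
    simpa [he] using norm_inner_le_norm (𝕜 := ℝ) (d n) e
  obtain ⟨g1, g2, g3⟩ := isLittleO_sampleGrad_sub hy H.mean θ (B e) hcr
  obtain ⟨f1, f2, f3⟩ := H.isLittleO_sampleGrad_add hy hd hdh e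
  have k1 := isLittleO_mul_sub_mul hc (f := fun n => crossAvg y θ n 1 (B e) + inner ℝ (d n) e)
    (F := fun n => sampleGrad y n 1 (θ + d n) (B e)) ((hcr 1 (by norm_num)).add hde)
    (((f1.trans_isBigO hdσ).add g1).congr_left fun n => by ring)
  have k2 := isLittleO_mul_sub_mul ha
    (f := fun n => crossAvg y θ n 2 (B e) - popMoment ν 2 θ * crossAvg y θ n 0 (B e))
    (F := fun n => sampleGrad y n 2 (θ + d n) (B e))
    ((hcr 2 (by norm_num)).sub ((hcr 0 (by norm_num)).const_mul_left _))
    (((f2.trans_isBigO hdσ).add g2).congr_left fun n => by ring)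
  have k3 := isLittleO_mul_sub_mul hb
    (f := fun n => crossAvg y θ n 3 (B e) - popMoment ν 3 θ * crossAvg y θ n 0 (B e) +
      3 * popMoment ν 2 θ * inner ℝ (d n) e)
    (F := fun n => sampleGrad y n 3 (θ + d n) (B e))
    (((hcr 3 (by norm_num)).sub ((hcr 0 (by norm_num)).const_mul_left _)).add
      (hde.const_mul_left _))
    (((f3.trans_isBigO hdσ).add g3).congr_left fun n => by ring)
  refine IsLittleO.congr' (k1.sub (k2.add k3)) ?_ EventuallyEq.rfl
  filter_upwards [hmax, hm2.eventually_ne hM, hv.eventually_ne hθ] with n hn h2 hne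
  have foc := sampleGrad_eq_zero_of_maximizer hne hn h2 (B e)
  have hdq : (inner ℝ (d n) e : ℝ) = d n q := by simp [he, EuclideanSpace.inner_single_right]
  rw [PiLp.add_apply, PiLp.smul_apply, H.scoreAvg_apply, ← he, smul_eq_mul, curvature, ← hdq]
  simp only [coefLin, Pi.div_apply]
  linear_combination -foc

lemma IsProjectionModel.isLittleO_add_scoreAvg {y : ℕ → E} {ν : Measure E} {θ h : E}
    {B : E →L[ℝ] E} (H : IsProjectionModel ν θ h B) (hy : MomentsConverge y ν) {d : ℕ → E}
    (hd : Tendsto d atTop (𝓝 0)) (hdh : ∀ n, (inner ℝ (d n) h : ℝ) = 0) {w₁ w₂ : ℝ}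
    (hM : popMoment ν 2 θ ≠ 0) (hcurv : curvature w₁ w₂ ν θ ≠ 0)
    (hmax : ∀ᶠ n in atTop, ∀ v, v ≠ 0 →
      hybridIndex w₁ w₂ y n v ≤ hybridIndex w₁ w₂ y n (θ + d n)) :
    (d =O[atTop] fluctuation θ B y) ∧
    (fun n => d n + (curvature w₁ w₂ ν θ)⁻¹ • scoreAvg w₁ w₂ ν θ B y n) =o[atTop]
      fluctuation θ B y := by
  have ht0 : ∀ n, 0 ≤ fluctuation θ B y n := fun n => Finset.sum_nonneg fun _ _ => abs_nonneg _
  have r := (H.isLittleO_residual hy hd hdh hM hmax).const_smul_left (curvature w₁ w₂ ν θ)⁻¹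
  replace r : (fun n => d n + (curvature w₁ w₂ ν θ)⁻¹ • scoreAvg w₁ w₂ ν θ B y n) =o[atTop]
      fun n => fluctuation θ B y n + ‖d n‖ := by
    refine r.congr_left fun n => ?_
    simp only [Pi.smul_apply]
    rw [smul_add, smul_smul, inv_mul_cancel₀ hcurv, one_smul, add_comm]
  have hs : (fun n => (curvature w₁ w₂ ν θ)⁻¹ • scoreAvg w₁ w₂ ν θ B y n) =O[atTop]
      fluctuation θ B y := by
    suffices h : scoreAvg w₁ w₂ ν θ B y =O[atTop] fluctuation θ B y from
      (h.const_smul_left (curvature w₁ w₂ ν θ)⁻¹).congr_left fun _ => rfl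
    have e : scoreAvg w₁ w₂ ν θ B y = fun n =>
        ∑ q, scoreAvg w₁ w₂ ν θ B y n q • EuclideanSpace.basisFun (Fin p) ℝ q := by
      ext1 n
      simpa using ((EuclideanSpace.basisFun (Fin p) ℝ).sum_repr (scoreAvg w₁ w₂ ν θ B y n)).symm
    rw [e]
    refine IsBigO.fun_sum fun q _ => IsBigO.trans (g := fun n => scoreAvg w₁ w₂ ν θ B y n q)
      (IsBigO.of_bound 1 (Eventually.of_forall fun n => by simp [norm_smul])) ?_
    simp only [H.scoreAvg_apply]
    have hc := fun j hj => isBigO_crossAvg θ B y q (j := j) hj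
    exact ((((hc 2 (by norm_num)).sub ((hc 0 (by norm_num)).const_mul_left _)).const_mul_left
      _).add (((hc 3 (by norm_num)).sub ((hc 0 (by norm_num)).const_mul_left _)).const_mul_left
      _)).sub ((hc 1 (by norm_num)).const_mul_left _)
  -- Bootstrap: once the residual is at most half of fluctuation + ‖d‖, the term ‖d‖ / 2 is absorbed
  -- on the left, which gives the constant 2C + 1.
  have hdO : d =O[atTop] fluctuation θ B y := by
    obtain ⟨C, hC⟩ := hs.bound
    refine IsBigO.of_bound (2 * C + 1) ?_
    filter_upwards [hC, r.def (by norm_num : (0 : ℝ) < 1 / 2)] with n h1 h2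
    rw [Real.norm_of_nonneg (ht0 n)] at h1 ⊢
    rw [Real.norm_of_nonneg (add_nonneg (ht0 n) (norm_nonneg _))] at h2
    have h3 : ‖d n‖ ≤ ‖d n + (curvature w₁ w₂ ν θ)⁻¹ • scoreAvg w₁ w₂ ν θ B y n‖ +
        ‖(curvature w₁ w₂ ν θ)⁻¹ • scoreAvg w₁ w₂ ν θ B y n‖ := by
      simpa using norm_sub_le (d n + (curvature w₁ w₂ ν θ)⁻¹ • scoreAvg w₁ w₂ ν θ B y n)
        ((curvature w₁ w₂ ν θ)⁻¹ • scoreAvg w₁ w₂ ν θ B y n)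
    linarith
  exact ⟨hdO, r.trans_isBigO ((isBigO_refl _ _).add hdO.norm_left)⟩

/-- The orthogonal projection onto the complement of `v`. -/
def orthoProjCLM (v : E) : E →L[ℝ] E :=
  ContinuousLinearMap.id ℝ E - (‖v‖ ^ 2)⁻¹ • (innerSL ℝ v).smulRight v

lemma orthoProjCLM_apply (v x : E) :
    orthoProjCLM v x = x - ((‖v‖ ^ 2)⁻¹ * inner ℝ v x) • v := by
  simp [orthoProjCLM, smul_smul]

lemma hasFDerivAt_normalize {v : E} (hv : v ≠ 0) :
    HasFDerivAt (fun x : E => ‖x‖⁻¹ • x) (‖v‖⁻¹ • orthoProjCLM v) v := by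
  have hn : ‖v‖ ≠ 0 := norm_ne_zero_iff.2 hv
  have h1 : HasFDerivAt (fun x : E => ‖x‖) (‖v‖⁻¹ • innerSL ℝ v) v := by
    have h2 := ((hasStrictFDerivAt_norm_sq v).hasFDerivAt).sqrt (pow_ne_zero 2 hn)
    simp only [Real.sqrt_sq (norm_nonneg _)] at h2
    refine h2.congr_fderiv ?_
    ext x
    simp
    field_simp
  have h3 := ((hasDerivAt_inv hn).comp_hasFDerivAt v h1).smul (hasFDerivAt_id v)
  refine h3.congr_fderiv ?_
  ext x q
  simp [orthoProjCLM_apply]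
  field_simp
  ring

/-- The linear expansion of unit maximizers near the discriminant direction. -/
theorem IsProjectionModel.isLittleO_maximizer {y : ℕ → E} {ν : Measure E} {θ h : E}
    {B : E →L[ℝ] E} (H : IsProjectionModel ν θ h B) (hy : MomentsConverge y ν) {w₁ w₂ : ℝ}
    (hM : popMoment ν 2 θ ≠ 0) (hcurv : curvature w₁ w₂ ν θ ≠ 0) {u : ℕ → E}
    (hu : Tendsto u atTop (𝓝 (‖θ‖⁻¹ • θ)))
    (hmax : ∀ᶠ n in atTop, IsSphereMaximizer (hybridIndex w₁ w₂ y n) (u n)) :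
    (fun n => u n - ‖θ‖⁻¹ • θ +
      ((curvature w₁ w₂ ν θ)⁻¹ * ‖θ‖⁻¹) • orthoProjCLM θ (scoreAvg w₁ w₂ ν θ B y n)) =o[atTop]
      fluctuation θ B y := by
  have hτ := H.inner_pos
  have hθ : θ ≠ 0 := by rintro rfl; simp at hτ
  have hn : 0 < ‖θ‖ := norm_pos_iff.2 hθ
  have hlim : Tendsto (fun n => (inner ℝ (u n) h : ℝ)) atTop (𝓝 (‖θ‖⁻¹ * inner ℝ θ h)) := by
    have := (((innerSL ℝ h).continuous.tendsto _).comp hu)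
    simpa [Function.comp_def, real_inner_comm, inner_smul_left] using this
  have hlim0 : 0 < ‖θ‖⁻¹ * (inner ℝ θ h : ℝ) := by positivity
  -- Rescale u n to the hyperplane ⟪·, h⟫ = ⟪θ, h⟫, so that d n is orthogonal to h. The default 0
  -- keeps this orthogonality for all n and is not used eventually, since ⟪u n, h⟫ has a positive
  -- limit.
  set d : ℕ → E := fun n => if (inner ℝ (u n) h : ℝ) = 0 then 0 else
    ((inner ℝ θ h : ℝ) / inner ℝ (u n) h) • u n - θ with hd
  have hdh : ∀ n, (inner ℝ (d n) h : ℝ) = 0 := by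
    intro n
    by_cases h0 : (inner ℝ (u n) h : ℝ) = 0
    · simp [hd, h0]
    · simp only [hd, h0, if_false]
      rw [inner_sub_left, inner_smul_left]
      simp [h0]
  have hde : ∀ᶠ n in atTop, θ + d n = ((inner ℝ θ h : ℝ) / inner ℝ (u n) h) • u n := by
    filter_upwards [hlim.eventually (lt_mem_nhds hlim0)] with n hn
    simp [hd, hn.ne']
  have hd0 : Tendsto d atTop (𝓝 0) := by
    have h1 : Tendsto (fun n => ((inner ℝ θ h : ℝ) / inner ℝ (u n) h) • u n) atTop
        (𝓝 (((inner ℝ θ h : ℝ) / (‖θ‖⁻¹ * inner ℝ θ h)) • (‖θ‖⁻¹ • θ))) :=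
      (tendsto_const_nhds.div hlim hlim0.ne').smul hu
    have h2 : ((inner ℝ θ h : ℝ) / (‖θ‖⁻¹ * inner ℝ θ h)) • (‖θ‖⁻¹ • θ) = θ := by
      rw [smul_smul]
      have : (inner ℝ θ h : ℝ) / (‖θ‖⁻¹ * inner ℝ θ h) * ‖θ‖⁻¹ = 1 := by field_simp
      rw [this, one_smul]
    rw [h2] at h1
    have h3 := (h1.congr' (hde.mono fun n hn => hn.symm)).sub_const θ
    simpa using h3
  have hmax' : ∀ᶠ n in atTop, ∀ v, v ≠ 0 →
      hybridIndex w₁ w₂ y n v ≤ hybridIndex w₁ w₂ y n (θ + d n) := by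
    filter_upwards [hmax, hde, hlim.eventually (lt_mem_nhds hlim0)] with n h1 h2 h3 v hv
    rw [h2, hybridIndex_smul w₁ w₂ y n (div_pos hτ h3).ne']
    exact h1.le_of_ne_zero hv
  obtain ⟨hO, ho⟩ := H.isLittleO_add_scoreAvg hy hd0 hdh hM hcurv hmax'
  have hv : Tendsto (fun n => θ + d n) atTop (𝓝 θ) := by simpa using hd0.const_add θ
  -- Delta method: normalizing θ + d n recovers u n, and the derivative of normalization projects
  -- orthogonally to θ.
  have hF := ((hasFDerivAt_normalize hθ).isLittleO.comp_tendsto hv)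
  have hF' : (fun n => ‖θ + d n‖⁻¹ • (θ + d n) - ‖θ‖⁻¹ • θ - (‖θ‖⁻¹ • orthoProjCLM θ) (d n))
      =o[atTop] fluctuation θ B y := by
    refine IsLittleO.trans_isBigO (hF.congr (fun n => ?_) (fun n => ?_)) hO
    · simp
    · simp
  have hL : (fun n => (‖θ‖⁻¹ • orthoProjCLM θ)
      (d n + (curvature w₁ w₂ ν θ)⁻¹ • scoreAvg w₁ w₂ ν θ B y n)) =o[atTop] fluctuation θ B y :=
    ((‖θ‖⁻¹ • orthoProjCLM θ).isBigO_comp _ _).trans_isLittleO ho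
  refine (hF'.add hL).congr' ?_ EventuallyEq.rfl
  filter_upwards [hmax, hde, hlim.eventually (lt_mem_nhds hlim0)] with n h1 h2 h3
  have hu1 : ‖u n‖ = 1 := by simpa using h1.1
  have hcn : 0 < (inner ℝ θ h : ℝ) / inner ℝ (u n) h := div_pos hτ h3
  rw [h2, norm_smul, hu1, mul_one, Real.norm_of_nonneg hcn.le, smul_smul,
    inv_mul_cancel₀ hcn.ne', one_smul, map_add, map_smul, smul_apply,
    smul_apply, smul_smul]
  abel

end MaximizerExpansion

/-! ### The population index and its maximizer -/

section Population

variable {p : ℕ}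

local notation "E" => EuclideanSpace ℝ (Fin p)

/-- The law of the centered observations. -/
def centeredMixture (α : ℝ) (h : E) (S : Matrix (Fin p) (Fin p) ℝ) : Measure E :=
  normalMixture α ((-(1 - α)) • h) (α • h) S

lemma popMoment_centeredMixture {α : ℝ} (h0 : 0 < α) (h1 : α < 1) (h u : E)
    {S : Matrix (Fin p) (Fin p) ℝ} (hS : S.PosSemidef) (k : ℕ) :
    popMoment (centeredMixture α h S) k u =
      α * gaussMoment (inner ℝ u (Matrix.toEuclideanCLM (𝕜 := ℝ) S u)) k
        (-(1 - α) * inner ℝ u h) +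
      (1 - α) * gaussMoment (inner ℝ u (Matrix.toEuclideanCLM (𝕜 := ℝ) S u)) k
        (α * inner ℝ u h) := by
  rw [popMoment, centeredMixture, integral_inner_pow_normalMixture h0 h1 _ _ _ hS,
    inner_smul_right, inner_smul_right]

lemma popMoments_centeredMixture {α : ℝ} (h0 : 0 < α) (h1 : α < 1) (h u : E)
    {S : Matrix (Fin p) (Fin p) ℝ} (hS : S.PosSemidef) {v t β : ℝ}
    (hv : inner ℝ u (Matrix.toEuclideanCLM (𝕜 := ℝ) S u) = v) (ht : inner ℝ u h = t)
    (hβ : α * (1 - α) = β) :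
    popMoment (centeredMixture α h S) 1 u = 0 ∧
    popMoment (centeredMixture α h S) 2 u = v + β * t ^ 2 ∧
    popMoment (centeredMixture α h S) 3 u = (2 * α - 1) * (β * t ^ 3) ∧
    popMoment (centeredMixture α h S) 4 u =
      3 * v ^ 2 + 6 * v * β * t ^ 2 + β * (1 - 3 * β) * t ^ 4 ∧
    popMoment (centeredMixture α h S) 5 u =
      (2 * α - 1) * (β * (1 - 2 * β) * t ^ 5 + 10 * v * β * t ^ 3) ∧
    popMoment (centeredMixture α h S) 6 u =
      15 * v ^ 3 + 45 * v ^ 2 * β * t ^ 2 + 15 * v * β * (1 - 3 * β) * t ^ 4 +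
        β * (1 - 5 * β + 5 * β ^ 2) * t ^ 6 := by
  subst hβ
  refine ⟨?_, ?_, ?_, ?_, ?_, ?_⟩ <;>
  · rw [popMoment_centeredMixture h0 h1 h u hS, hv, ht]
    simp [gaussMoment]
    ring

/-- The squared skewness is β²(1 - 4β)r³, because (2α - 1)² = 1 - 4β, and the excess kurtosis is β(1
- 6β)r². The direction enters only through r = t² / (v + βt²). -/
lemma popIndex_centeredMixture {α : ℝ} (h0 : 0 < α) (h1 : α < 1) (h u : E)
    {S : Matrix (Fin p) (Fin p) ℝ} (hS : S.PosSemidef) {v t β : ℝ}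
    (hv : inner ℝ u (Matrix.toEuclideanCLM (𝕜 := ℝ) S u) = v) (ht : inner ℝ u h = t)
    (hβ : α * (1 - α) = β) (hpos : v + β * t ^ 2 ≠ 0) (w₁ w₂ : ℝ) :
    popIndex w₁ w₂ (centeredMixture α h S) u =
      w₁ * (β ^ 2 * (1 - 4 * β)) * (t ^ 2 / (v + β * t ^ 2)) ^ 3 +
      w₂ * (β ^ 2 * (1 - 6 * β) ^ 2) * (t ^ 2 / (v + β * t ^ 2)) ^ 4 := by
  obtain ⟨-, m2, m3, m4, -⟩ := popMoments_centeredMixture h0 h1 h u hS hv ht hβ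
  rw [popIndex, indexOfMoments, m2, m3, m4]
  have e1 : ((2 * α - 1) * (β * t ^ 3)) ^ 2 / (v + β * t ^ 2) ^ 3 =
      (β ^ 2 * (1 - 4 * β)) * (t ^ 2 / (v + β * t ^ 2)) ^ 3 := by
    rw [div_pow, ← mul_div_assoc]
    congr 1
    rw [← hβ]
    ring
  have e2 : (3 * v ^ 2 + 6 * v * β * t ^ 2 + β * (1 - 3 * β) * t ^ 4) / (v + β * t ^ 2) ^ 2 - 3 =
      β * (1 - 6 * β) * (t ^ 2 / (v + β * t ^ 2)) ^ 2 := by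
    field_simp
    ring
  rw [e1, e2]
  ring

lemma four_mul_le_one {α β : ℝ} (hβ : α * (1 - α) = β) : 4 * β ≤ 1 := by
  nlinarith [sq_nonneg (2 * α - 1)]

/-- Strict monotonicity: if 4β = 1 the skewness term is lost, but then 1 - 6β ≠ 0 and the kurtosis
term is strictly increasing. -/
lemma le_of_index_le {w₁ w₂ β r r' : ℝ} (hw₁ : 0 < w₁) (hw₂ : 0 < w₂) (hβ0 : 0 < β)
    (hβ : 4 * β ≤ 1) (hr' : 0 ≤ r')
    (hle : w₁ * (β ^ 2 * (1 - 4 * β)) * r ^ 3 + w₂ * (β ^ 2 * (1 - 6 * β) ^ 2) * r ^ 4 ≤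
      w₁ * (β ^ 2 * (1 - 4 * β)) * r' ^ 3 + w₂ * (β ^ 2 * (1 - 6 * β) ^ 2) * r' ^ 4) :
    r ≤ r' := by
  by_contra! hlt
  have h3 : r' ^ 3 < r ^ 3 := by gcongr
  have h4 : r' ^ 4 < r ^ 4 := by gcongr
  have c1 : 0 ≤ w₁ * (β ^ 2 * (1 - 4 * β)) :=
    mul_nonneg hw₁.le (mul_nonneg (sq_nonneg _) (by linarith))
  have c2 : 0 ≤ w₂ * (β ^ 2 * (1 - 6 * β) ^ 2) := by positivity
  by_cases h : 4 * β = 1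
  · have c2' : 0 < w₂ * (β ^ 2 * (1 - 6 * β) ^ 2) := by
      have : 1 - 6 * β ≠ 0 := by intro hh; linarith
      positivity
    nlinarith
  · have c1' : 0 < w₁ * (β ^ 2 * (1 - 4 * β)) :=
      mul_pos hw₁ (mul_pos (by positivity) (by
        rcases hβ.lt_or_eq with h' | h'
        · linarith
        · exact absurd h' h))
    nlinarith

lemma inner_toEuclideanCLM_pos {S : Matrix (Fin p) (Fin p) ℝ} (hS : S.PosDef) {u : E}
    (hu : u ≠ 0) : 0 < (inner ℝ u (Matrix.toEuclideanCLM (𝕜 := ℝ) S u) : ℝ) := by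
  rw [Matrix.inner_toEuclideanCLM]
  simpa using hS.dotProduct_mulVec_pos (x := u.ofLp) (by simpa using hu)

/-- The discriminant direction is the unique maximizer of the population index up to sign. -/
lemma eq_of_popIndex_le {α : ℝ} (h0 : 0 < α) (h1 : α < 1) {h θ : E}
    {S : Matrix (Fin p) (Fin p) ℝ} (hS : S.PosDef)
    (hθ : Matrix.toEuclideanCLM (𝕜 := ℝ) S θ = h) (hτ : 0 < (inner ℝ θ h : ℝ))
    {w₁ w₂ : ℝ} (hw₁ : 0 < w₁) (hw₂ : 0 < w₂) {v : E} (hv : ‖v‖ = 1)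
    (hvθ : 0 ≤ (inner ℝ θ v : ℝ))
    (hle : popIndex w₁ w₂ (centeredMixture α h S) (‖θ‖⁻¹ • θ) ≤
      popIndex w₁ w₂ (centeredMixture α h S) v) : v = ‖θ‖⁻¹ • θ := by
  set τ : ℝ := inner ℝ θ h with hτd
  set T := Matrix.toEuclideanCLM (𝕜 := ℝ) S with hT
  set β := α * (1 - α) with hβ
  have hβ0 : 0 < β := mul_pos h0 (by linarith)
  have hθ0 : θ ≠ 0 := by rintro rfl; simp [hτd] at hτ
  have hn : 0 < ‖θ‖ := norm_pos_iff.2 hθ0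
  have hv0 : v ≠ 0 := by rintro rfl; simp at hv
  have hvT : 0 < (inner ℝ v (T v) : ℝ) := inner_toEuclideanCLM_pos hS hv0
  set t : ℝ := inner ℝ v h with ht
  set V : ℝ := inner ℝ v (T v) with hV
  have e1 : (inner ℝ (‖θ‖⁻¹ • θ) (T (‖θ‖⁻¹ • θ)) : ℝ) = ‖θ‖⁻¹ ^ 2 * τ := by
    rw [map_smul, hθ, inner_smul_left, inner_smul_right]
    simp
    ring
  have e2 : (inner ℝ (‖θ‖⁻¹ • θ) h : ℝ) = ‖θ‖⁻¹ * τ := by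
    rw [inner_smul_left]; simp [hτd]
  rw [popIndex_centeredMixture h0 h1 h _ hS.posSemidef e1 e2 hβ.symm (by positivity),
    popIndex_centeredMixture h0 h1 h v hS.posSemidef rfl rfl hβ.symm (by positivity)] at hle
  have hr := le_of_index_le hw₁ hw₂ hβ0 (four_mul_le_one hβ.symm) (by positivity) hle
  rw [div_le_div_iff₀ (by positivity) (by positivity)] at hr
  -- The reverse of the Cauchy-Schwarz inequality for S; the terms in β cancel after
  -- cross-multiplication.
  have hr2 : τ * V ≤ t ^ 2 := by
    have h3 : 0 < ‖θ‖⁻¹ ^ 2 * τ := by positivity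
    have h4 : (‖θ‖⁻¹ ^ 2 * τ) * (τ * V) ≤ (‖θ‖⁻¹ ^ 2 * τ) * t ^ 2 := by nlinarith
    exact le_of_mul_le_mul_left h4 h3
  -- Equality case: the S-quadratic form of this vector is V - t² / τ ≤ 0, and S is positive
  -- definite.
  have hw : v - (t / τ) • θ = 0 := by
    by_contra hne
    have hpos := inner_toEuclideanCLM_pos hS hne
    have hq : (inner ℝ (v - (t / τ) • θ) (T (v - (t / τ) • θ)) : ℝ) = V - t ^ 2 / τ := by
      have h5 : (inner ℝ θ (T v) : ℝ) = t := by
        rw [hT, toEuclideanCLM_symm hS.posSemidef, hθ, ht, real_inner_comm]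
      rw [map_sub, map_smul, hθ, inner_sub_left, inner_sub_right, inner_sub_right,
        inner_smul_left, inner_smul_left, inner_smul_right, inner_smul_right, h5]
      simp only [conj_trivial, ← hτd, ← ht, ← hV]
      field_simp
      ring
    rw [hq] at hpos
    have : V ≤ t ^ 2 / τ := by rw [le_div_iff₀ hτ]; linarith
    linarith
  have hvt : v = (t / τ) • θ := sub_eq_zero.1 hw
  have hc : 0 ≤ t / τ := by
    rw [hvt, inner_smul_right, real_inner_self_eq_norm_sq] at hvθ
    exact nonneg_of_mul_nonneg_left hvθ (by positivity)
  have hc2 : t / τ = ‖θ‖⁻¹ := by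
    have h6 := hv
    rw [hvt, norm_smul, Real.norm_of_nonneg hc] at h6
    exact eq_inv_of_mul_eq_one_left h6
  rw [← hc2]
  exact hvt

lemma popMoment_two_ne_zero {α : ℝ} (h0 : 0 < α) (h1 : α < 1) (h : E)
    {S : Matrix (Fin p) (Fin p) ℝ} (hS : S.PosDef) {u : E} (hu : u ≠ 0) :
    popMoment (centeredMixture α h S) 2 u ≠ 0 := by
  have h2 := inner_toEuclideanCLM_pos hS hu
  rw [(popMoments_centeredMixture h0 h1 h u hS.posSemidef rfl rfl rfl).2.1]
  have : 0 < α * (1 - α) := mul_pos h0 (by linarith)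
  positivity

/-- The covariance operator of the residuals, inverted on the complement of `h`. -/
def residualInv (S : Matrix (Fin p) (Fin p) ℝ) (θ h : E) : E →L[ℝ] E :=
  Matrix.toEuclideanCLM (𝕜 := ℝ) S⁻¹ - (inner ℝ θ h : ℝ)⁻¹ • (innerSL ℝ θ).smulRight θ

lemma residualInv_apply (S : Matrix (Fin p) (Fin p) ℝ) (θ h e : E) :
    residualInv S θ h e =
      Matrix.toEuclideanCLM (𝕜 := ℝ) S⁻¹ e - ((inner ℝ θ h : ℝ)⁻¹ * inner ℝ θ e) • θ := by
  simp [residualInv, smul_smul]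

lemma toEuclideanCLM_mul_inv {S : Matrix (Fin p) (Fin p) ℝ} (hS : S.PosDef) (e : E) :
    Matrix.toEuclideanCLM (𝕜 := ℝ) S (Matrix.toEuclideanCLM (𝕜 := ℝ) S⁻¹ e) = e := by
  rw [← mul_apply_eq_comp, ← map_mul,
    Matrix.mul_nonsing_inv _ ((Matrix.isUnit_iff_isUnit_det _).1 hS.isUnit)]
  simp

lemma toEuclideanCLM_residualInv {S : Matrix (Fin p) (Fin p) ℝ} (hS : S.PosDef) {θ h : E}
    (hθ : Matrix.toEuclideanCLM (𝕜 := ℝ) S θ = h) (e : E) :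
    Matrix.toEuclideanCLM (𝕜 := ℝ) S (residualInv S θ h e) =
      e - ((inner ℝ θ h : ℝ)⁻¹ * inner ℝ θ e) • h := by
  rw [residualInv_apply, map_sub, map_smul, toEuclideanCLM_mul_inv hS, hθ]

lemma inner_residualInv {S : Matrix (Fin p) (Fin p) ℝ} (hS : S.PosDef) {θ h : E}
    (hθ : Matrix.toEuclideanCLM (𝕜 := ℝ) S θ = h) (hτ : 0 < (inner ℝ θ h : ℝ)) (e : E) :
    (inner ℝ (residualInv S θ h e) h : ℝ) = 0 := by
  conv_lhs => rw [← hθ]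
  rw [toEuclideanCLM_symm hS.posSemidef, hθ, toEuclideanCLM_residualInv hS hθ, inner_sub_left,
    inner_smul_left, real_inner_comm θ h, real_inner_comm θ e]
  simp only [conj_trivial]
  field_simp
  ring

/-- All cross moments come from one factorization: the k-th moment of ⟪θ, ·⟫ times ⟪d, S B e⟫, where
S B e differs from e by a multiple of h and d is orthogonal to h. -/
theorem isProjectionModel_centeredMixture {α : ℝ} (h0 : 0 < α) (h1 : α < 1) {h θ : E}
    {S : Matrix (Fin p) (Fin p) ℝ} (hS : S.PosDef)
    (hθ : Matrix.toEuclideanCLM (𝕜 := ℝ) S θ = h) (hτ : 0 < (inner ℝ θ h : ℝ)) :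
    IsProjectionModel (centeredMixture α h S) θ h (residualInv S θ h) := by
  have hmean : ∀ u : E, ∫ z, (inner ℝ u z : ℝ) ∂centeredMixture α h S = 0 := fun u => by
    simpa [popMoment] using (popMoments_centeredMixture h0 h1 h u hS.posSemidef rfl rfl rfl).1
  have hprob : IsProbabilityMeasure (centeredMixture α h S) :=
    isProbabilityMeasure_normalMixture h0 h1 _ _ S
  have horth := inner_residualInv hS hθ hτ
  have hcross : ∀ (k : ℕ) (d e : E), (inner ℝ d h : ℝ) = 0 →
      ∫ z, (inner ℝ θ z) ^ k * (inner ℝ d z * inner ℝ (residualInv S θ h e) z)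
        ∂centeredMixture α h S = popMoment (centeredMixture α h S) k θ * (inner ℝ d e : ℝ) := by
    intro k d e hd
    have := (integral_mul_normalMixture h0 h1 hS.posSemidef hθ hτ (-(1 - α)) α
      (f := fun s => s ^ k) (by fun_prop)
      (fun μ => (hasAllMoments_inner_multivariateGaussian θ μ S).pow k) hd (horth e)).2
    rw [toEuclideanCLM_residualInv hS hθ, inner_sub_right, inner_smul_right, hd, mul_zero,
      sub_zero] at this
    exact this
  refine ⟨hprob, fun u => hasAllMoments_inner_normalMixture u α _ _ S, hmean, hτ, ?_, ?_, ?_, ?_⟩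
  · intro u v
    have hs : (inner ℝ (Matrix.toEuclideanCLM (𝕜 := ℝ) S⁻¹ u) v : ℝ) =
        inner ℝ u (Matrix.toEuclideanCLM (𝕜 := ℝ) S⁻¹ v) :=
      (toEuclideanCLM_symm hS.inv.posSemidef u v).symm
    rw [residualInv_apply, residualInv_apply, inner_sub_left, inner_sub_right, hs, inner_smul_left,
      inner_smul_right, real_inner_comm θ u]
    simp only [conj_trivial]
    ring
  · intro d e hd
    have := hcross 0 d e hd
    simpa [popMoment] using this
  · intro d e hd
    have := hcross 1 d e hd
    rw [(popMoments_centeredMixture h0 h1 h θ hS.posSemidef rfl rfl rfl).1, zero_mul] at this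
    rw [← this]
    congr 1
    ext z
    ring
  · intro d e hd
    rw [← hcross 2 d e hd]
    congr 1
    ext z
    ring

end Population

/-! ### Curvature, score variance and the constant C_η -/

section Variance

variable {p : ℕ}

local notation "E" => EuclideanSpace ℝ (Fin p)

lemma curvature_eq {α : ℝ} (h0 : 0 < α) (h1 : α < 1) {h θ : E}
    {S : Matrix (Fin p) (Fin p) ℝ} (hS : S.PosDef)
    (hθ : Matrix.toEuclideanCLM (𝕜 := ℝ) S θ = h) {τ β : ℝ} (hτ : inner ℝ θ h = τ) (hτ0 : 0 < τ)
    (hβ : α * (1 - α) = β) (w₁ w₂ : ℝ) :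
    curvature w₁ w₂ (centeredMixture α h S) θ =
      -(2 * β ^ 2 * τ ^ 2 / (1 + β * τ) ^ 5) *
        (3 * w₁ * (1 + β * τ) * (1 - 4 * β) + 4 * w₂ * τ * (1 - 6 * β) ^ 2) := by
  have hβ0 : 0 < β := hβ ▸ mul_pos h0 (by linarith)
  -- At u = θ the variance v and the mean gap t are both τ, since Sθ = h.
  obtain ⟨-, m2, m3, m4, -, -⟩ := popMoments_centeredMixture h0 h1 h θ hS.posSemidef
    (v := τ) (t := τ) (by rw [hθ, hτ]) hτ hβ
  have hκ : (2 * α - 1) ^ 2 = 1 - 4 * β := by rw [← hβ]; ring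
  have hD : 0 < 1 + β * τ := by positivity
  have m2' : popMoment (centeredMixture α h S) 2 θ = τ * (1 + β * τ) := by rw [m2]; ring
  rw [curvature, coefLin, coefKurt, coefSkew, m2', m3, m4]
  generalize 2 * α - 1 = κ at hκ
  field_simp
  rw [hκ]
  ring

lemma curvature_ne_zero {α : ℝ} (h0 : 0 < α) (h1 : α < 1) {h θ : E}
    {S : Matrix (Fin p) (Fin p) ℝ} (hS : S.PosDef)
    (hθ : Matrix.toEuclideanCLM (𝕜 := ℝ) S θ = h) (hτ0 : 0 < (inner ℝ θ h : ℝ))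
    {w₁ w₂ : ℝ} (hw₁ : 0 < w₁) (hw₂ : 0 < w₂) :
    curvature w₁ w₂ (centeredMixture α h S) θ ≠ 0 := by
  rw [curvature_eq h0 h1 hS hθ rfl hτ0 rfl]
  have hβ0 : 0 < α * (1 - α) := mul_pos h0 (by linarith)
  have h4 := four_mul_le_one (α := α) rfl
  set β := α * (1 - α)
  set τ : ℝ := inner ℝ θ h
  have h5 : 0 < 3 * w₁ * (1 + β * τ) * (1 - 4 * β) + 4 * w₂ * τ * (1 - 6 * β) ^ 2 := by
    rcases h4.lt_or_eq with h | h
    · have : 0 < 1 - 4 * β := by linarith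
      positivity
    · have e1 : 1 - 4 * β = 0 := by linarith
      have e2 : (1 - 6 * β) ≠ 0 := by intro hh; linarith
      rw [e1]
      positivity
  have h6 : 0 < 2 * β ^ 2 * τ ^ 2 / (1 + β * τ) ^ 5 := by positivity
  exact mul_ne_zero (neg_ne_zero.2 h6.ne') h5.ne'

lemma integral_score_sq_eq_moments {ν : Measure E} [IsProbabilityMeasure ν] {θ : E}
    (hν : HasAllMoments (fun z => inner ℝ θ z) ν) (w₁ w₂ : ℝ) (hm : popMoment ν 1 θ = 0) :
    ∫ z, score w₁ w₂ ν θ (inner ℝ θ z) ^ 2 ∂ν =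
      coefSkew w₁ ν θ ^ 2 * (popMoment ν 4 θ - popMoment ν 2 θ ^ 2) +
      coefKurt w₂ ν θ ^ 2 * (popMoment ν 6 θ - popMoment ν 3 θ ^ 2) +
      coefLin w₁ w₂ ν θ ^ 2 * popMoment ν 2 θ +
      2 * coefSkew w₁ ν θ * coefKurt w₂ ν θ *
        (popMoment ν 5 θ - popMoment ν 2 θ * popMoment ν 3 θ) -
      2 * coefSkew w₁ ν θ * coefLin w₁ w₂ ν θ * popMoment ν 3 θ -
      2 * coefKurt w₂ ν θ * coefLin w₁ w₂ ν θ * popMoment ν 4 θ := by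
  set a := coefSkew w₁ ν θ
  set b := coefKurt w₂ ν θ
  set r := coefLin w₁ w₂ ν θ
  set c := -(a * popMoment ν 2 θ + b * popMoment ν 3 θ) with hc
  have hi : ∀ (k : ℕ) (x : ℝ), Integrable (fun z => x * (inner ℝ θ z) ^ k) ν := fun k x =>
    ((hν.pow k).const_mul x).integrable
  have e : (fun z => score w₁ w₂ ν θ (inner ℝ θ z) ^ 2) = fun z =>
      c ^ 2 * (inner ℝ θ z) ^ 0 + (-2 * c * r) * (inner ℝ θ z) ^ 1 +
      (r ^ 2 + 2 * c * a) * (inner ℝ θ z) ^ 2 + (2 * c * b - 2 * r * a) * (inner ℝ θ z) ^ 3 +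
      (a ^ 2 - 2 * r * b) * (inner ℝ θ z) ^ 4 + (2 * a * b) * (inner ℝ θ z) ^ 5 +
      b ^ 2 * (inner ℝ θ z) ^ 6 := by
    ext z
    simp only [score, hc]
    ring
  have hM : ∀ (k : ℕ) (x : ℝ), ∫ z, x * (inner ℝ θ z) ^ k ∂ν = x * popMoment ν k θ := fun k x => by
    rw [integral_const_mul, popMoment]
  have hM0 : popMoment ν 0 θ = 1 := by simp [popMoment]
  rw [e, integral_add, integral_add, integral_add, integral_add, integral_add, integral_add,
    hM, hM, hM, hM, hM, hM, hM, hm, hM0]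
  · rw [hc]
    ring
  all_goals
    repeat' first
      | exact hi _ _
      | apply Integrable.add

/-- The odd moments and the skewness coefficient each carry a factor κ = 2α - 1. It occurs only
squared here, so the score variance depends on α through β alone. -/
lemma quadratic_form_of_sq_eq {κ q : ℝ} (hκ : κ ^ 2 = q) (A b r M₂ M₄ M₆ m₃ m₅ : ℝ) :
    (κ * A) ^ 2 * (M₄ - M₂ ^ 2) + b ^ 2 * (M₆ - (κ * m₃) ^ 2) + r ^ 2 * M₂ +
      2 * (κ * A) * b * (κ * m₅ - M₂ * (κ * m₃)) - 2 * (κ * A) * r * (κ * m₃) - 2 * b * r * M₄ =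
    q * (A ^ 2 * (M₄ - M₂ ^ 2) - b ^ 2 * m₃ ^ 2 + 2 * A * b * (m₅ - M₂ * m₃) - 2 * A * r * m₃) +
      b ^ 2 * M₆ + r ^ 2 * M₂ - 2 * b * r * M₄ := by
  subst hκ
  ring

/-- The sandwich ratio of score variance to squared curvature is C_η(1 + βτ) / β; the missing ‖θ‖⁻²
of the limit covariance comes from normalization. -/
theorem integral_score_sq {α : ℝ} (h0 : 0 < α) (h1 : α < 1) {h θ : E}
    {S : Matrix (Fin p) (Fin p) ℝ} (hS : S.PosDef)
    (hθ : Matrix.toEuclideanCLM (𝕜 := ℝ) S θ = h) {τ β : ℝ} (hτ : inner ℝ θ h = τ) (hτ0 : 0 < τ)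
    (hβ : α * (1 - α) = β) {w₁ w₂ : ℝ} (hw₁ : 0 < w₁) (hw₂ : 0 < w₂) :
    ∫ z, score w₁ w₂ (centeredMixture α h S) θ (inner ℝ θ z) ^ 2 ∂centeredMixture α h S =
      curvature w₁ w₂ (centeredMixture α h S) θ ^ 2 *
        (hybridConst β τ w₁ w₂ * (1 + β * τ) / β) := by
  have hβ0 : 0 < β := hβ ▸ mul_pos h0 (by linarith)
  have : IsProbabilityMeasure (centeredMixture α h S) :=
    isProbabilityMeasure_normalMixture h0 h1 _ _ S
  have hcurv := curvature_ne_zero h0 h1 hS hθ (hτ ▸ hτ0) hw₁ hw₂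
  rw [curvature_eq h0 h1 hS hθ hτ hτ0 hβ] at hcurv ⊢
  obtain ⟨m1, m2, m3, m4, m5, m6⟩ := popMoments_centeredMixture h0 h1 h θ hS.posSemidef
    (v := τ) (t := τ) (by rw [hθ, hτ]) hτ hβ
  have hκ : (2 * α - 1) ^ 2 = 1 - 4 * β := by rw [← hβ]; ring
  have hD : 0 < 1 + β * τ := by positivity
  have m2' : popMoment (centeredMixture α h S) 2 θ = τ * (1 + β * τ) := by rw [m2]; ring
  have hν : HasAllMoments (fun z => inner ℝ θ z) (centeredMixture α h S) :=
    hasAllMoments_inner_normalMixture θ α _ _ S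
  have hK := right_ne_zero_of_mul hcurv
  set K := 3 * w₁ * (1 + β * τ) * (1 - 4 * β) + 4 * w₂ * τ * (1 - 6 * β) ^ 2 with hKd
  have ha : coefSkew w₁ (centeredMixture α h S) θ =
      (2 * α - 1) * (6 * w₁ * β / (1 + β * τ) ^ 3) := by
    rw [coefSkew, m2', m3]
    field_simp
  have hb : coefKurt w₂ (centeredMixture α h S) θ =
      8 * w₂ * β * (1 - 6 * β) / (1 + β * τ) ^ 4 := by
    rw [coefKurt, m2', m4]
    field_simp
    ring
  have hr : coefLin w₁ w₂ (centeredMixture α h S) θ =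
      2 * β * τ / (1 + β * τ) ^ 5 * (3 * w₁ * β * (1 - 4 * β) * τ * (1 + β * τ) +
        12 * w₂ * (1 - 6 * β) * (1 + β * τ) ^ 2 +
        4 * w₂ * β * (1 - 6 * β) ^ 2 * τ ^ 2) := by
    rw [coefLin, ha, hb, m2', m3, m4, ← hκ]
    field_simp
    ring
  have hC : hybridConst β τ w₁ w₂ * (β * τ ^ 2 * K ^ 2) =
      (1 + β * τ) * (1 - 4 * β) *
      (9 * w₁ ^ 2 * (1 + β * τ) * (2 + 6 * β * τ + β * τ ^ 2)
        + 24 * w₁ * w₂ * τ ^ 2 * β * (1 - 6 * β) * (6 + τ)) +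
      16 * w₂ ^ 2 * τ * (1 - 6 * β) ^ 2 * deltaPoly β τ := by
    rw [hybridConst, ← hKd, ← add_div, div_mul_cancel₀ _ (by positivity)]
  have hrhs : (-(2 * β ^ 2 * τ ^ 2 / (1 + β * τ) ^ 5) * K) ^ 2 *
        (hybridConst β τ w₁ w₂ * (1 + β * τ) / β) =
      4 * β ^ 2 * τ ^ 2 / (1 + β * τ) ^ 9 * (hybridConst β τ w₁ w₂ * (β * τ ^ 2 * K ^ 2)) := by
    field_simp
    ring
  rw [hrhs, hC, integral_score_sq_eq_moments hν w₁ w₂ m1, ha, hb, hr, m2', m3, m4, m5, m6, deltaPoly]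
  rw [quadratic_form_of_sq_eq hκ]
  field_simp
  ring

end Variance

/-! ### Influence function and its covariance -/

section Limit

variable {p : ℕ}

local notation "E" => EuclideanSpace ℝ (Fin p)

lemma toEuclideanCLM_orthoProj (v : E) :
    Matrix.toEuclideanCLM (𝕜 := ℝ) (orthoProj v) = orthoProjCLM v := by
  ext x q
  simp [orthoProj, orthoProjCLM_apply, Matrix.vecMulVec_mulVec, PiLp.inner_apply, dotProduct]
  simp only [mul_comm]
  ring

lemma transpose_orthoProj (v : E) : (orthoProj v).transpose = orthoProj v := by
  simp [orthoProj, Matrix.transpose_vecMulVec]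

lemma orthoProjCLM_symm (v x y : E) :
    (inner ℝ (orthoProjCLM v x) y : ℝ) = inner ℝ x (orthoProjCLM v y) := by
  rw [orthoProjCLM_apply, orthoProjCLM_apply, inner_sub_left, inner_sub_right, inner_smul_left,
    inner_smul_right, real_inner_comm v x]
  simp only [conj_trivial]
  ring

lemma inner_orthoProjCLM_self {v : E} (hv : v ≠ 0) (x : E) :
    (inner ℝ v (orthoProjCLM v x) : ℝ) = 0 := by
  have hn : ‖v‖ ≠ 0 := norm_ne_zero_iff.2 hv
  rw [orthoProjCLM_apply, inner_sub_right, inner_smul_right, real_inner_self_eq_norm_sq]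
  field_simp
  ring

lemma posSemidef_sandwich {S : Matrix (Fin p) (Fin p) ℝ} (hS : S.PosDef) (v : E) {c : ℝ}
    (hc : 0 ≤ c) : (c • (orthoProj v * S⁻¹ * orthoProj v)).PosSemidef := by
  have h := hS.inv.posSemidef.mul_mul_conjTranspose_same (orthoProj v)
  rw [Matrix.conjTranspose_eq_transpose_of_trivial, transpose_orthoProj] at h
  exact h.smul hc

lemma inner_sandwich (S : Matrix (Fin p) (Fin p) ℝ) (v t : E) (c : ℝ) :
    (inner ℝ t (Matrix.toEuclideanCLM (𝕜 := ℝ) (c • (orthoProj v * S⁻¹ * orthoProj v)) t) : ℝ) =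
      c * inner ℝ (orthoProjCLM v t)
        (Matrix.toEuclideanCLM (𝕜 := ℝ) S⁻¹ (orthoProjCLM v t)) := by
  rw [map_smul, map_mul, map_mul, toEuclideanCLM_orthoProj, smul_apply, inner_smul_right,
    mul_apply_eq_comp, mul_apply_eq_comp, orthoProjCLM_symm]

lemma hasAllMoments_score {ν : Measure E} [IsProbabilityMeasure ν] {θ : E}
    (hν : HasAllMoments (fun z => inner ℝ θ z) ν) (ν' : Measure E) (w₁ w₂ : ℝ) :
    HasAllMoments (fun z => score w₁ w₂ ν' θ (inner ℝ θ z)) ν :=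
  (((HasAllMoments.const _).mul ((hν.pow 2).sub (.const _))).add
    ((HasAllMoments.const _).mul ((hν.pow 3).sub (.const _)))).sub
    ((HasAllMoments.const _).mul hν)

/-- The second moment of the scores in a direction orthogonal to `θ`. -/
lemma integral_score_mul_sq {α : ℝ} (h0 : 0 < α) (h1 : α < 1) {h θ : E}
    {S : Matrix (Fin p) (Fin p) ℝ} (hS : S.PosDef)
    (hθ : Matrix.toEuclideanCLM (𝕜 := ℝ) S θ = h) (hτ : 0 < (inner ℝ θ h : ℝ)) (w₁ w₂ : ℝ) {e : E}
    (he : (inner ℝ θ e : ℝ) = 0) :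
    ∫ z, (score w₁ w₂ (centeredMixture α h S) θ (inner ℝ θ z) *
        inner ℝ (residualInv S θ h e) z) ^ 2 ∂centeredMixture α h S =
      (∫ z, score w₁ w₂ (centeredMixture α h S) θ (inner ℝ θ z) ^ 2 ∂centeredMixture α h S) *
        inner ℝ e (Matrix.toEuclideanCLM (𝕜 := ℝ) S⁻¹ e) := by
  have horth := inner_residualInv hS hθ hτ e
  have key := (integral_mul_normalMixture h0 h1 hS.posSemidef hθ hτ (-(1 - α)) α
    (f := fun s => score w₁ w₂ (centeredMixture α h S) θ s ^ 2)
    (by unfold score; fun_prop)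
    (fun μ => (hasAllMoments_score (hasAllMoments_inner_multivariateGaussian θ μ S)
      (centeredMixture α h S) w₁ w₂).pow 2) horth horth).2
  rw [toEuclideanCLM_residualInv hS hθ, he, mul_zero, zero_smul, sub_zero, residualInv_apply, he,
    mul_zero, zero_smul, sub_zero, real_inner_comm] at key
  rw [residualInv_apply, he, mul_zero, zero_smul, sub_zero]
  refine Eq.trans ?_ key
  congr 1
  ext z
  ring

lemma isProbabilityMeasure_centeredMixture {α : ℝ} (h0 : 0 < α) (h1 : α < 1) (h : E)
    (S : Matrix (Fin p) (Fin p) ℝ) : IsProbabilityMeasure (centeredMixture α h S) :=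
  isProbabilityMeasure_normalMixture h0 h1 _ _ S

lemma continuous_score (w₁ w₂ : ℝ) (ν : Measure E) (θ : E) : Continuous (score w₁ w₂ ν θ) := by
  unfold score
  fun_prop

/-- The influence function of the maximizer. -/
def influence (w₁ w₂ : ℝ) (ν : Measure E) (θ : E) (B : E →L[ℝ] E) (z : E) : E :=
  (-((curvature w₁ w₂ ν θ)⁻¹ * ‖θ‖⁻¹)) •
    orthoProjCLM θ (score w₁ w₂ ν θ (inner ℝ θ z) • B z)

lemma continuous_influence (w₁ w₂ : ℝ) (ν : Measure E) (θ : E) (B : E →L[ℝ] E) :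
    Continuous (influence w₁ w₂ ν θ B) := by
  have := continuous_score w₁ w₂ ν θ
  unfold influence
  fun_prop

lemma IsProjectionModel.inner_influence {ν : Measure E} {θ h : E} {B : E →L[ℝ] E}
    (H : IsProjectionModel ν θ h B) (w₁ w₂ : ℝ) (t z : E) :
    (inner ℝ t (influence w₁ w₂ ν θ B z) : ℝ) = (-((curvature w₁ w₂ ν θ)⁻¹ * ‖θ‖⁻¹)) *
      (score w₁ w₂ ν θ (inner ℝ θ z) * inner ℝ (B (orthoProjCLM θ t)) z) := by
  rw [influence, inner_smul_right, ← orthoProjCLM_symm, inner_smul_right, H.symm]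

lemma sum_influence (w₁ w₂ : ℝ) (ν : Measure E) (θ : E) (B : E →L[ℝ] E) (y : ℕ → E) (n : ℕ) :
    ((curvature w₁ w₂ ν θ)⁻¹ * ‖θ‖⁻¹) • orthoProjCLM θ (scoreAvg w₁ w₂ ν θ B y n) =
      -((n : ℝ)⁻¹ • ∑ i ∈ Finset.range n, influence w₁ w₂ ν θ B (y i)) := by
  unfold influence scoreAvg
  rw [← Finset.smul_sum, ← map_sum, map_smul, smul_smul, smul_smul, ← neg_smul]
  congr 1
  ring

lemma integral_continuous_mul_inner_residualInv {α : ℝ} (h0 : 0 < α) (h1 : α < 1) {h θ : E}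
    {S : Matrix (Fin p) (Fin p) ℝ} (hS : S.PosDef)
    (hθ : Matrix.toEuclideanCLM (𝕜 := ℝ) S θ = h) (hτ : 0 < (inner ℝ θ h : ℝ)) {f : ℝ → ℝ}
    (hf : Continuous f)
    (hf' : ∀ μ, HasAllMoments (fun y => f (inner ℝ θ y)) (multivariateGaussian μ S)) (e : E) :
    ∫ z, f (inner ℝ θ z) * inner ℝ (residualInv S θ h e) z ∂centeredMixture α h S = 0 :=
  (integral_mul_normalMixture h0 h1 hS.posSemidef hθ hτ (-(1 - α)) α hf hf'
    (inner_residualInv hS hθ hτ e) (inner_residualInv hS hθ hτ e)).1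

end Limit

/-! ### Asymptotic normality for the centered sample -/

section Assembly

variable {p : ℕ}

local notation "E" => EuclideanSpace ℝ (Fin p)

lemma HasAllMoments.memLp_comp {Ω : Type*} [MeasurableSpace Ω] {P : Measure Ω} {ν : Measure E}
    {f : E → ℝ} (hf : HasAllMoments f ν) {Y : Ω → E} (hY : HasLaw Y ν P) :
    MemLp (fun ω => f (Y ω)) 2 P := by
  have := hf 2
  rw [← hY.map_eq] at this
  exact this.comp_of_map hY.aemeasurable

theorem tendstoInDistribution_sum_influence {Ω : Type*} [MeasurableSpace Ω] {P : Measure Ω}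
    [IsProbabilityMeasure P] {α : ℝ} (h0 : 0 < α) (h1 : α < 1) {h θ : E}
    {S : Matrix (Fin p) (Fin p) ℝ} (hS : S.PosDef)
    (hθ : Matrix.toEuclideanCLM (𝕜 := ℝ) S θ = h) {τ β : ℝ} (hτ : inner ℝ θ h = τ) (hτ0 : 0 < τ)
    (hβ : α * (1 - α) = β) {w₁ w₂ : ℝ} (hw₁ : 0 < w₁) (hw₂ : 0 < w₂)
    {y : ℕ → Ω → E} (hlaw : ∀ i, HasLaw (y i) (centeredMixture α h S) P) (hind : iIndepFun y P) :
    TendstoInDistribution (fun (n : ℕ) ω => (√(n : ℝ))⁻¹ • ∑ i ∈ Finset.range n,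
        influence w₁ w₂ (centeredMixture α h S) θ (residualInv S θ h) (y i ω)) atTop
      (id : E → E) (fun _ => P)
      (multivariateGaussian 0 ((hybridConst β τ w₁ w₂ * ((1 + β * τ) / (‖θ‖ ^ 2 * β))) •
        (orthoProj θ * S⁻¹ * orthoProj θ))) := by
  have hprob := isProbabilityMeasure_centeredMixture h0 h1 h S
  have H := isProjectionModel_centeredMixture h0 h1 hS hθ (hτ ▸ hτ0)
  set ν := centeredMixture α h S with hν
  set B := residualInv S θ h with hB
  have hβ0 : 0 < β := hβ ▸ mul_pos h0 (by linarith)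
  have hθ0 : θ ≠ 0 := by rintro rfl; simp at hτ; exact hτ0.ne hτ
  have hn : 0 < ‖θ‖ := norm_pos_iff.2 hθ0
  have hcurv := curvature_ne_zero h0 h1 hS hθ (hτ ▸ hτ0) hw₁ hw₂
  have hV := integral_score_sq h0 h1 hS hθ hτ hτ0 hβ hw₁ hw₂
  rw [← hν] at hcurv hV
  set lam := curvature w₁ w₂ ν θ with hlam
  set C := hybridConst β τ w₁ w₂ with hC
  -- Positive semidefiniteness of the limit covariance is read off from the integral of a square, as
  -- the sign of C_η is not evident from its formula.
  have hcnn : 0 ≤ C * ((1 + β * τ) / (‖θ‖ ^ 2 * β)) := by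
    have hVnn : 0 ≤ lam ^ 2 * (C * (1 + β * τ) / β) := by
      rw [← hV]
      exact integral_nonneg fun z => sq_nonneg _
    have hl2 : 0 < lam ^ 2 := by positivity
    have h3 : 0 ≤ C * (1 + β * τ) / β := nonneg_of_mul_nonneg_right hVnn hl2
    have h4 : C * ((1 + β * τ) / (‖θ‖ ^ 2 * β)) = (C * (1 + β * τ) / β) / ‖θ‖ ^ 2 := by
      field_simp
    rw [h4]
    positivity
  have hmi := continuous_influence w₁ w₂ ν θ B
  have hall : ∀ t : E, HasAllMoments (fun z => (inner ℝ t (influence w₁ w₂ ν θ B z) : ℝ)) ν := by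
    intro t
    simp only [H.inner_influence]
    exact ((hasAllMoments_score (H.moments θ) ν w₁ w₂).mul (H.moments _)).const_mul _
  have hmean : ∀ t : E, ∫ z, (inner ℝ t (influence w₁ w₂ ν θ B z) : ℝ) ∂ν = 0 := by
    intro t
    simp only [H.inner_influence]
    rw [integral_const_mul, hν, hB, integral_continuous_mul_inner_residualInv h0 h1 hS hθ
      (hτ ▸ hτ0) (continuous_score w₁ w₂ _ θ) (fun μ => hasAllMoments_score
        (hasAllMoments_inner_multivariateGaussian θ μ S) _ w₁ w₂), mul_zero]
  have hcont : ∀ t : E, Continuous fun z => (inner ℝ t (influence w₁ w₂ ν θ B z) : ℝ) :=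
    fun t => by fun_prop
  have htrans : ∀ {f : E → ℝ}, Continuous f → ∫ ω, f (y 0 ω) ∂P = ∫ z, f z ∂ν := fun hf =>
    (hlaw 0).integral_comp hf.aestronglyMeasurable
  have hmean' : ∀ t : E, ∫ ω, (inner ℝ t (influence w₁ w₂ ν θ B (y 0 ω)) : ℝ) ∂P = 0 :=
    fun t => (htrans (hcont t)).trans (hmean t)
  refine tendstoInDistribution_inv_sqrt_smul_sum
    (hind.comp (fun _ => influence w₁ w₂ ν θ B) fun _ => hmi.measurable)
    (fun i => ((hlaw i).identDistrib (hlaw 0)).comp hmi.measurable)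
    (fun t => (hall t).memLp_comp (hlaw 0)) hmean' fun t => ?_
  rw [map_inner_multivariateGaussian t 0 (posSemidef_sandwich hS θ hcnn), inner_zero_right,
    inner_sandwich]
  congr 2
  simp only [Function.comp_apply]
  rw [variance_of_integral_eq_zero ((hall t).memLp_comp (hlaw 0)).aemeasurable (hmean' t)]
  rw [htrans (f := fun z => (inner ℝ t (influence w₁ w₂ ν θ B z) : ℝ) ^ 2) ((hcont t).pow 2)]
  simp only [H.inner_influence, mul_pow]
  rw [integral_const_mul]
  simp only [← mul_pow]
  rw [hν, hB, integral_score_mul_sq h0 h1 hS hθ (hτ ▸ hτ0) w₁ w₂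
    (inner_orthoProjCLM_self hθ0 t), ← hν, hV, ← hlam]
  field_simp

theorem tendstoInDistribution_maximizer {Ω : Type*} [MeasurableSpace Ω] {P : Measure Ω}
    [IsProbabilityMeasure P] {α : ℝ} (h0 : 0 < α) (h1 : α < 1) {h θ : E}
    {S : Matrix (Fin p) (Fin p) ℝ} (hS : S.PosDef)
    (hθ : Matrix.toEuclideanCLM (𝕜 := ℝ) S θ = h) {τ β : ℝ} (hτ : inner ℝ θ h = τ) (hτ0 : 0 < τ)
    (hβ : α * (1 - α) = β) {w₁ w₂ : ℝ} (hw₁ : 0 < w₁) (hw₂ : 0 < w₂)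
    {y : ℕ → Ω → E} (hlaw : ∀ i, HasLaw (y i) (centeredMixture α h S) P) (hind : iIndepFun y P)
    {u : ℕ → Ω → E} (hu_meas : ∀ n, AEMeasurable (u n) P)
    (hu_max : ∀ᵐ ω ∂P, ∀ᶠ n in atTop,
      IsSphereMaximizer (hybridIndex w₁ w₂ (fun i => y i ω) n) (u n ω))
    (hu_sign : ∀ᵐ ω ∂P, ∀ n, 0 ≤ (inner ℝ θ (u n ω) : ℝ)) :
    (∀ᵐ ω ∂P, Tendsto (fun n => u n ω) atTop (𝓝 (‖θ‖⁻¹ • θ))) ∧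
    TendstoInDistribution (fun (n : ℕ) ω => √(n : ℝ) • (u n ω - ‖θ‖⁻¹ • θ)) atTop
      (id : E → E) (fun _ => P)
      (multivariateGaussian 0 ((hybridConst β τ w₁ w₂ * ((1 + β * τ) / (‖θ‖ ^ 2 * β))) •
        (orthoProj θ * S⁻¹ * orthoProj θ))) := by
  have hprob := isProbabilityMeasure_centeredMixture h0 h1 h S
  have H := isProjectionModel_centeredMixture h0 h1 hS hθ (hτ ▸ hτ0)
  have hclt := tendstoInDistribution_sum_influence h0 h1 hS hθ hτ hτ0 hβ hw₁ hw₂ hlaw hind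
  have hcurv := curvature_ne_zero h0 h1 hS hθ (hτ ▸ hτ0) hw₁ hw₂
  have hθ0 : θ ≠ 0 := by rintro rfl; simp at hτ; exact hτ0.ne hτ
  have hn : 0 < ‖θ‖ := norm_pos_iff.2 hθ0
  have hmoments : Integrable (fun z : E => (1 + ‖z‖) ^ 4) (centeredMixture α h S) := by
    have hnorm : HasAllMoments (fun z : E => ‖z‖) (centeredMixture α h S) := by
      have hg : ∀ μ, HasAllMoments (fun z : E => ‖z‖) (multivariateGaussian μ S) := fun μ q =>
        (IsGaussian.memLp_id (multivariateGaussian μ S) q (by simp)).norm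
      exact (hg _).normalMixture (hg _)
    exact (((HasAllMoments.const 1).add hnorm).pow 4).integrable
  have hconv := ae_momentsConverge y hlaw hind hmoments
  have hcons : ∀ᵐ ω ∂P, Tendsto (fun n => u n ω) atTop (𝓝 (‖θ‖⁻¹ • θ)) := by
    filter_upwards [hconv, hu_max, hu_sign] with ω hy hmax hs
    exact hy.tendsto_maximizer H.mean (fun v hv => popMoment_two_ne_zero h0 h1 h hS hv)
      (by rw [norm_smul, norm_inv, norm_norm, inv_mul_cancel₀ hn.ne'])
      (fun v hv hvθ hle => eq_of_popIndex_le h0 h1 hS hθ (hτ ▸ hτ0) hw₁ hw₂ hv hvθ hle) hmax hs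
  refine ⟨hcons, ?_⟩
  set ν := centeredMixture α h S with hν
  set B := residualInv S θ h with hB
  set R : ℕ → Ω → E := fun n ω => u n ω - ‖θ‖⁻¹ • θ -
    (n : ℝ)⁻¹ • ∑ i ∈ Finset.range n, influence w₁ w₂ ν θ B (y i ω) with hR
  have hmi := (continuous_influence w₁ w₂ ν θ B).measurable
  have hRm : ∀ n, AEMeasurable (R n) P := fun n => by
    have hsum : AEMeasurable
        (fun ω => ∑ i ∈ Finset.range n, influence w₁ w₂ ν θ B (y i ω)) P :=
      Finset.aemeasurable_fun_sum _ fun i _ => hmi.comp_aemeasurable (hlaw i).aemeasurable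
    exact ((hu_meas n).sub_const _).sub (hsum.fun_const_smul _)
  set X : Fin 4 × Fin p → ℕ → Ω → ℝ := fun jq i ω => (inner ℝ θ (y i ω) : ℝ) ^ (jq.1 : ℕ) *
    inner ℝ (B (EuclideanSpace.single jq.2 1)) (y i ω) with hX
  have hXc : ∀ jq : Fin 4 × Fin p, Continuous fun z : E => (inner ℝ θ z : ℝ) ^ (jq.1 : ℕ) *
      inner ℝ (B (EuclideanSpace.single jq.2 1)) z := fun jq => by fun_prop
  have hRo : ∀ᵐ ω ∂P, (fun n => R n ω) =o[atTop]
      fun n : ℕ => ∑ jq, |(n : ℝ)⁻¹ * ∑ i ∈ Finset.range n, X jq i ω| := by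
    filter_upwards [hconv, hu_max, hcons] with ω hy hmax hc
    refine (H.isLittleO_maximizer hy (popMoment_two_ne_zero h0 h1 h hS hθ0) hcurv hc
      hmax).congr_left fun n => ?_
    rw [sum_influence]
    simp only [hR]
    abel
  have hneg := tendstoInMeasure_sqrt_smul_of_isLittleO (P := P) (X := X)
    (fun jq => hind.comp _ fun _ => (hXc jq).measurable)
    (fun jq i => ((hlaw i).identDistrib (hlaw 0)).comp (hXc jq).measurable)
    (fun jq => (((H.moments θ).pow _).mul (H.moments _)).memLp_comp (hlaw 0))
    (fun jq => by
      have e1 := (hlaw 0).integral_comp (hXc jq).aestronglyMeasurable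
      have e2 := integral_continuous_mul_inner_residualInv h0 h1 hS hθ (hτ ▸ hτ0)
        (f := fun s => s ^ (jq.1 : ℕ)) (by fun_prop) (fun μ =>
          (hasAllMoments_inner_multivariateGaussian θ μ S).pow _) (EuclideanSpace.single jq.2 1)
      exact e1.trans e2) hRm hRo
  -- Slutsky: √n times the remainder R tends to 0 in probability.
  refine tendstoInDistribution_of_tendstoInMeasure_sub _ _ hclt ?_
    (fun n => ((hu_meas n).sub_const _).fun_const_smul _)
  refine hneg.congr_left fun n => Eventually.of_forall fun ω => ?_
  have hsq : √(n : ℝ) * (n : ℝ)⁻¹ = (√(n : ℝ))⁻¹ := by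
    rcases Nat.eq_zero_or_pos n with rfl | hpos
    · simp
    · have : (0 : ℝ) < n := by exact_mod_cast hpos
      rw [← div_eq_mul_inv, Real.sqrt_div_self']
      simp
  simp only [hR, Pi.sub_apply, smul_sub, smul_smul, hsq]

end Assembly

end HybridPP

end

/-! ### Centering, choice of signs and conclusion -/

theorem theorem3 {Ω : Type*} [MeasurableSpace Ω] (P : Measure Ω) [IsProbabilityMeasure P]
    {p : ℕ} (α₁ : ℝ) (hα₀ : 0 < α₁) (hα₁ : α₁ < 1)
    (μ₁ μ₂ : EuclideanSpace ℝ (Fin p)) (hμ : μ₁ ≠ μ₂)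
    (S : Matrix (Fin p) (Fin p) ℝ) (hS : S.PosDef)
    (w₁ w₂ : ℝ) (hw₁ : 0 < w₁) (hw₂ : 0 < w₂)
    (x : ℕ → Ω → EuclideanSpace ℝ (Fin p))
    (hx_law : ∀ i, HasLaw (x i) (HybridPP.normalMixture α₁ μ₁ μ₂ S) P)
    (hx_indep : iIndepFun x P)
    (u : ℕ → Ω → EuclideanSpace ℝ (Fin p))
    (hu_meas : ∀ n, AEMeasurable (u n) P)
    (hu_max : ∀ᵐ ω ∂P, ∀ᶠ n in atTop,
      HybridPP.IsSphereMaximizer (HybridPP.hybridIndex w₁ w₂ (fun i => x i ω) n) (u n ω)) :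
    ∃ s : ℕ → Ω → ℝ,
      (∀ n, Measurable (s n)) ∧
      (∀ n ω, s n ω = -1 ∨ s n ω = 1) ∧
      (∀ᵐ ω ∂P, Tendsto (fun n => s n ω • u n ω) atTop
        (𝓝 (‖HybridPP.discriminant μ₁ μ₂ S‖⁻¹ • HybridPP.discriminant μ₁ μ₂ S))) ∧
      TendstoInDistribution
        (fun (n : ℕ) ω => √(n : ℝ) •
          (s n ω • u n ω - ‖HybridPP.discriminant μ₁ μ₂ S‖⁻¹ • HybridPP.discriminant μ₁ μ₂ S))
        atTop (id : EuclideanSpace ℝ (Fin p) → EuclideanSpace ℝ (Fin p)) (fun _ => P)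
        (multivariateGaussian 0
          (HybridPP.hybridConst (α₁ * (1 - α₁)) (HybridPP.mahalanobisSq μ₁ μ₂ S) w₁ w₂ •
            HybridPP.ldaCovariance α₁ μ₁ μ₂ S)) := by
  set h : EuclideanSpace ℝ (Fin p) := μ₂ - μ₁ with hh
  set θ := HybridPP.discriminant μ₁ μ₂ S with hθdef
  have hθ : Matrix.toEuclideanCLM (𝕜 := ℝ) S θ = h := HybridPP.toEuclideanCLM_mul_inv hS h
  have hτ : inner ℝ θ h = HybridPP.mahalanobisSq μ₁ μ₂ S := real_inner_comm _ _
  have hτ0 : 0 < HybridPP.mahalanobisSq μ₁ μ₂ S :=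
    HybridPP.inner_toEuclideanCLM_pos hS.inv (sub_ne_zero.2 hμ.symm)
  -- The mean of the mixture: subtracting it moves the component means to -(1 - α₁)h and α₁h.
  set m : EuclideanSpace ℝ (Fin p) := α₁ • μ₁ + (1 - α₁) • μ₂ with hm
  have hlaw : ∀ i, HasLaw (fun ω => x i ω - m) (HybridPP.centeredMixture α₁ h S) P := fun i => by
    refine ⟨(hx_law i).aemeasurable.sub_const _, ?_⟩
    have e1 : μ₁ - m = (-(1 - α₁)) • h := by rw [hm, hh]; module
    have e2 : μ₂ - m = α₁ • h := by rw [hm, hh]; module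
    rw [HybridPP.centeredMixture, ← e1, ← e2, ← HybridPP.normalMixture_map_sub,
      ← (hx_law i).map_eq, AEMeasurable.map_map_of_aemeasurable (by fun_prop)
        (hx_law i).aemeasurable]
    rfl
  have hind : iIndepFun (fun i ω => x i ω - m) P :=
    hx_indep.comp (fun _ z => z - m) fun _ => by fun_prop
  -- The sign is taken from a measurable version of u n, so that s n is measurable and not only
  -- almost everywhere so; it puts s n • u n in the half-space 0 ≤ ⟪θ, ·⟫ almost surely.
  set s : ℕ → Ω → ℝ := fun n ω => if 0 ≤ (inner ℝ θ ((hu_meas n).mk _ ω) : ℝ) then 1 else -1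
    with hs
  have hs_meas : ∀ n, Measurable (s n) := fun n => by
    have hmk := (hu_meas n).measurable_mk
    exact Measurable.ite (measurableSet_le measurable_const (by fun_prop)) measurable_const
      measurable_const
  have hs_val : ∀ n ω, s n ω = -1 ∨ s n ω = 1 := fun n ω => by
    rw [hs]
    dsimp only
    split_ifs <;> simp
  have hs_sign : ∀ᵐ ω ∂P, ∀ n, 0 ≤ (inner ℝ θ (s n ω • u n ω) : ℝ) := by
    filter_upwards [ae_all_iff.2 fun n => (hu_meas n).ae_eq_mk] with ω hω n
    rw [inner_smul_right, hω n, hs]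
    dsimp only
    split_ifs with hle
    · simpa using hle
    · push Not at hle
      linarith
  have hs_max : ∀ᵐ ω ∂P, ∀ᶠ n in atTop, HybridPP.IsSphereMaximizer
      (HybridPP.hybridIndex w₁ w₂ (fun i => x i ω - m) n) (s n ω • u n ω) := by
    filter_upwards [hu_max] with ω hω
    filter_upwards [hω] with n hn
    rw [HybridPP.hybridIndex_sub_const]
    exact hn.smul_sign (hs_val n ω)
  obtain ⟨hcons, hlim⟩ := HybridPP.tendstoInDistribution_maximizer hα₀ hα₁ hS hθ hτ hτ0 rfl hw₁ hw₂
    hlaw hind (fun n => (hs_meas n).aemeasurable.smul (hu_meas n)) hs_max hs_sign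
  refine ⟨s, hs_meas, hs_val, hcons, ?_⟩
  rw [HybridPP.ldaCovariance, smul_smul]
  exact hlim
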